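/- For $1<p<\infty$, $\frac1p+\frac1q=1$ and $0<\gamma<1$, let $Ti(p,\gamma)$ be the completion of the space $c_{00}$ of finitely supported real sequences under the unique norm that satisfies $$\|a\|=\max\Big\{\|a\|_\infty,\ \gamma\,\sup\frac{\sum_{j=1}^n\|E_ja\|}{n^{1/q}}\Big\},$$ where the supremum is over all $n\ge 1$ and all finite nonempty sets $E_1<\dots<E_n$ of natural numbers ($E<F$ means $\max E<\min F$), and $E_ja$ is the restriction of $a$ to $E_j$. Let $(e_j)$ be the sequence of unit vectors in $Ti(p,\gamma)$. Two sequences $(x_j)$, $(y_j)$ in Banach spaces are equivalent if, for all real scalars $(a_j)$, $\sum_j a_jx_j$ converges if and only if $\sum_j a_jy_j$ converges. A Schauder basis $(x_j)_{j=1}^\infty$ is subsymmetric if it is unconditional and equivalent to each of its subsequences. **Theorem.** For every $1<p<\infty$ there is $\gamma_0>0$ such that for every $0<\gamma<1$ with $\gamma<\gamma_0$ and every closed subspace $M$ of $Ti(p,\gamma)$, every subsymmetric basis of the quotient space $Ti(p,\gamma)/M$ is equivalent to $(e_j)$. -/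

import Mathlib

open Filter Topology

noncomputable section

/-! ### The Tirilman norm on the finitely supported sequences -/

/-- `E₁ < E₂ < ⋯ < Eₙ`: finite nonempty sets of natural numbers with
`max Eᵢ < min Eⱼ` whenever `i < j`. -/
def IsSuccessive {n : ℕ} (E : Fin n → Finset ℕ) : Prop :=
  (∀ j, (E j).Nonempty) ∧ ∀ i j, i < j → ∀ x ∈ E i, ∀ y ∈ E j, x < y

/-- For a function `N` on `c₀₀`, the set of all numbers `(∑ⱼ N (Eⱼ a)) / n ^ (1 / q)`, where
`1 / p + 1 / q = 1`, `n ≥ 1` and `E₁ < ⋯ < Eₙ`. Here `Eⱼ a` is the restriction of `a` to `Eⱼ`. -/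
def tirilmanAverages (p : ℝ) (N : (ℕ →₀ ℝ) → ℝ) (a : ℕ →₀ ℝ) : Set ℝ :=
  {r | ∃ (n : ℕ) (E : Fin n → Finset ℕ), 0 < n ∧ IsSuccessive E ∧
    r = (∑ j, N (a.filter (· ∈ E j))) / (n : ℝ) ^ (1 / Real.conjExponent p)}

/-- The recursive sequence of norms: the first one is the supremum norm. -/
def tirilmanNormAux (p γ : ℝ) : ℕ → (ℕ →₀ ℝ) → ℝ
  | 0, a => ⨆ i, |a i|
  | m + 1, a =>
    max (tirilmanNormAux p γ m a) (γ * sSup (tirilmanAverages p (tirilmanNormAux p γ m) a))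

/-- The norm of `Ti(p, γ)` on `c₀₀`, the limit of the (increasing) recursive sequence of norms.
`tirilmanNorm_eq` and `tirilmanNorm_unique` below show that it is the unique norm which satisfies
`‖a‖ = max {‖a‖_∞, γ sup (∑ⱼ ‖Eⱼ a‖) / n ^ (1 / q)}`. -/
def tirilmanNorm (p γ : ℝ) (a : ℕ →₀ ℝ) : ℝ :=
  ⨆ m, tirilmanNormAux p γ m a

section NormFacts

open scoped Pointwise

theorem bddAbove_abs (a : ℕ →₀ ℝ) : BddAbove (Set.range fun i => |a i|) := by
  refine ⟨∑ i ∈ a.support, |a i|, ?_⟩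
  rintro _ ⟨i, rfl⟩
  by_cases hi : i ∈ a.support
  · exact Finset.single_le_sum (f := fun i => |a i|) (fun _ _ => abs_nonneg _) hi
  · have : a i = 0 := by simpa using hi
    simp only [this, abs_zero]
    exact Finset.sum_nonneg fun _ _ => abs_nonneg _

theorem iSup_abs_nonneg (a : ℕ →₀ ℝ) : 0 ≤ ⨆ i, |a i| :=
  Real.iSup_nonneg fun _ => abs_nonneg _

theorem iSup_abs_le_sum (a : ℕ →₀ ℝ) : ⨆ i, |a i| ≤ ∑ i ∈ a.support, |a i| := by
  refine ciSup_le fun i => ?_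
  by_cases hi : i ∈ a.support
  · exact Finset.single_le_sum (f := fun i => |a i|) (fun _ _ => abs_nonneg _) hi
  · have : a i = 0 := by simpa using hi
    simp only [this, abs_zero]
    exact Finset.sum_nonneg fun _ _ => abs_nonneg _

theorem sum_abs_filter (a : ℕ →₀ ℝ) (s : Finset ℕ) :
    ∑ i ∈ (a.filter (· ∈ s)).support, |a.filter (· ∈ s) i| =
      ∑ i ∈ a.support with i ∈ s, |a i| := by
  rw [Finsupp.support_filter]
  refine Finset.sum_congr rfl fun i hi => ?_
  rw [Finsupp.filter_apply_pos _ _ (Finset.mem_filter.1 hi).2]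

theorem IsSuccessive.disjoint {n : ℕ} {E : Fin n → Finset ℕ} (hE : IsSuccessive E)
    {i j : Fin n} (hij : i ≠ j) : Disjoint (E i) (E j) := by
  rw [Finset.disjoint_left]
  intro x hi hj
  rcases lt_or_gt_of_ne hij with h | h
  · exact lt_irrefl _ (hE.2 i j h x hi x hj)
  · exact lt_irrefl _ (hE.2 j i h x hj x hi)

theorem sum_sum_abs_filter_le {n : ℕ} {E : Fin n → Finset ℕ} (hE : IsSuccessive E)
    (a : ℕ →₀ ℝ) :
    ∑ j, ∑ i ∈ (a.filter (· ∈ E j)).support, |a.filter (· ∈ E j) i| ≤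
      ∑ i ∈ a.support, |a i| := by
  simp only [sum_abs_filter]
  rw [← Finset.sum_biUnion]
  · exact Finset.sum_le_sum_of_subset_of_nonneg
      (Finset.biUnion_subset.2 fun j _ => Finset.filter_subset _ _) fun _ _ _ => abs_nonneg _
  · intro i _ j _ hij
    rw [Function.onFun, Finset.disjoint_left]
    intro x hx hy
    exact Finset.disjoint_left.1 (hE.disjoint hij) (Finset.mem_filter.1 hx).2
      (Finset.mem_filter.1 hy).2

variable {p γ : ℝ}

theorem one_le_rpow_conj (hp : 1 < p) {n : ℕ} (hn : 0 < n) :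
    1 ≤ (n : ℝ) ^ (1 / Real.conjExponent p) := by
  refine Real.one_le_rpow (by exact_mod_cast hn) ?_
  unfold Real.conjExponent
  have : 0 < p - 1 := by linarith
  positivity

theorem tirilmanAverages_nonempty (p : ℝ) (N : (ℕ →₀ ℝ) → ℝ) (a : ℕ →₀ ℝ) :
    (tirilmanAverages p N a).Nonempty :=
  ⟨_, 1, fun _ => {0}, one_pos, ⟨fun _ => by simp, fun i j hij => by omega⟩, rfl⟩

theorem tirilmanAverages_nonneg {N : (ℕ →₀ ℝ) → ℝ} (hN : ∀ a, 0 ≤ N a) (a : ℕ →₀ ℝ) :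
    ∀ r ∈ tirilmanAverages p N a, 0 ≤ r := by
  rintro r ⟨n, E, -, -, rfl⟩
  exact div_nonneg (Finset.sum_nonneg fun _ _ => hN _) (Real.rpow_nonneg (Nat.cast_nonneg n) _)

theorem tirilmanAverages_le_sum (hp : 1 < p) {N : (ℕ →₀ ℝ) → ℝ}
    (hN : ∀ a, N a ≤ ∑ i ∈ a.support, |a i|) (a : ℕ →₀ ℝ) :
    ∀ r ∈ tirilmanAverages p N a, r ≤ ∑ i ∈ a.support, |a i| := by
  rintro r ⟨n, E, hn, hE, rfl⟩
  have h1 := one_le_rpow_conj hp hn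
  rw [div_le_iff₀ (by linarith)]
  have h2 := (Finset.sum_le_sum fun j _ => hN (a.filter (· ∈ E j))).trans
    (sum_sum_abs_filter_le hE a)
  have h3 : 0 ≤ ∑ i ∈ a.support, |a i| := Finset.sum_nonneg fun _ _ => abs_nonneg _
  nlinarith

theorem bddAbove_tirilmanAverages (hp : 1 < p) {N : (ℕ →₀ ℝ) → ℝ}
    (hN : ∀ a, N a ≤ ∑ i ∈ a.support, |a i|) (a : ℕ →₀ ℝ) :
    BddAbove (tirilmanAverages p N a) :=
  ⟨_, tirilmanAverages_le_sum hp hN a⟩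

theorem tirilmanNormAux_nonneg (m : ℕ) (a : ℕ →₀ ℝ) : 0 ≤ tirilmanNormAux p γ m a := by
  induction m with
  | zero => exact iSup_abs_nonneg a
  | succ m ih => exact le_max_of_le_left ih

theorem tirilmanNormAux_le_sum (hp : 1 < p) (h0 : 0 < γ) (h1 : γ < 1) (m : ℕ) :
    ∀ a, tirilmanNormAux p γ m a ≤ ∑ i ∈ a.support, |a i| := by
  induction m with
  | zero => exact iSup_abs_le_sum
  | succ m ih =>
    intro a
    refine max_le (ih a) ?_
    have h2 := csSup_le (tirilmanAverages_nonempty p _ a) (tirilmanAverages_le_sum hp ih a)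
    have h3 : 0 ≤ ∑ i ∈ a.support, |a i| := Finset.sum_nonneg fun _ _ => abs_nonneg _
    nlinarith

theorem tirilmanNormAux_mono (a : ℕ →₀ ℝ) : Monotone fun m => tirilmanNormAux p γ m a :=
  monotone_nat_of_le_succ fun _ => le_max_left _ _

theorem bddAbove_tirilmanNormAux (hp : 1 < p) (h0 : 0 < γ) (h1 : γ < 1) (a : ℕ →₀ ℝ) :
    BddAbove (Set.range fun m => tirilmanNormAux p γ m a) := by
  refine ⟨∑ i ∈ a.support, |a i|, ?_⟩
  rintro _ ⟨m, rfl⟩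
  exact tirilmanNormAux_le_sum hp h0 h1 m a

theorem tendsto_tirilmanNormAux (hp : 1 < p) (h0 : 0 < γ) (h1 : γ < 1) (a : ℕ →₀ ℝ) :
    Tendsto (fun m => tirilmanNormAux p γ m a) atTop (𝓝 (tirilmanNorm p γ a)) :=
  tendsto_atTop_ciSup (tirilmanNormAux_mono a) (bddAbove_tirilmanNormAux hp h0 h1 a)

theorem tirilmanNormAux_le (hp : 1 < p) (h0 : 0 < γ) (h1 : γ < 1) (m : ℕ) (a : ℕ →₀ ℝ) :
    tirilmanNormAux p γ m a ≤ tirilmanNorm p γ a :=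
  le_ciSup (bddAbove_tirilmanNormAux hp h0 h1 a) m

theorem tirilmanNorm_le_sum (hp : 1 < p) (h0 : 0 < γ) (h1 : γ < 1) (a : ℕ →₀ ℝ) :
    tirilmanNorm p γ a ≤ ∑ i ∈ a.support, |a i| :=
  ciSup_le fun m => tirilmanNormAux_le_sum hp h0 h1 m a

theorem tirilmanNormAux_smul (m : ℕ) (c : ℝ) :
    ∀ a, tirilmanNormAux p γ m (c • a) = |c| * tirilmanNormAux p γ m a := by
  induction m with
  | zero =>
    intro a
    simp only [tirilmanNormAux, Finsupp.smul_apply, smul_eq_mul, abs_mul]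
    rw [Real.mul_iSup_of_nonneg (abs_nonneg c)]
  | succ m ih =>
    intro a
    have h : tirilmanAverages p (tirilmanNormAux p γ m) (c • a) =
        |c| • tirilmanAverages p (tirilmanNormAux p γ m) a := by
      ext r
      simp only [tirilmanAverages, Set.mem_ofPred_eq, Set.mem_smul_set, Finsupp.filter_smul, ih,
        ← Finset.mul_sum, mul_div_assoc, smul_eq_mul]
      constructor
      · rintro ⟨n, E, hn, hE, rfl⟩
        exact ⟨_, ⟨n, E, hn, hE, rfl⟩, rfl⟩
      · rintro ⟨_, ⟨n, E, hn, hE, rfl⟩, rfl⟩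
        exact ⟨n, E, hn, hE, rfl⟩
    simp only [tirilmanNormAux]
    rw [h, Real.sSup_smul_of_nonneg (abs_nonneg c), ih, smul_eq_mul,
      mul_max_of_nonneg _ _ (abs_nonneg c)]
    congr 1
    ring

theorem tirilmanNormAux_add_le (hp : 1 < p) (h0 : 0 < γ) (h1 : γ < 1) (m : ℕ) :
    ∀ a b, tirilmanNormAux p γ m (a + b) ≤ tirilmanNormAux p γ m a + tirilmanNormAux p γ m b := by
  induction m with
  | zero =>
    intro a b
    refine ciSup_le fun i => ?_
    exact (abs_add_le (a i) (b i)).trans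
      (add_le_add (le_ciSup (bddAbove_abs a) i) (le_ciSup (bddAbove_abs b) i))
  | succ m ih =>
    intro a b
    have hb := fun c => bddAbove_tirilmanAverages hp (tirilmanNormAux_le_sum (p := p) hp h0 h1 m) c
    refine max_le ((ih a b).trans (add_le_add (le_max_left _ _) (le_max_left _ _))) ?_
    refine le_trans ?_ (add_le_add (le_max_right _ _) (le_max_right _ _))
    rw [← mul_add]
    refine mul_le_mul_of_nonneg_left (csSup_le (tirilmanAverages_nonempty p _ _) ?_) h0.le
    rintro r ⟨n, E, hn, hE, rfl⟩
    refine le_trans ?_ (add_le_add (le_csSup (hb a) ⟨n, E, hn, hE, rfl⟩)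
      (le_csSup (hb b) ⟨n, E, hn, hE, rfl⟩))
    rw [← add_div, ← Finset.sum_add_distrib]
    refine div_le_div_of_nonneg_right (Finset.sum_le_sum fun j _ => ?_)
      (Real.rpow_nonneg (Nat.cast_nonneg n) _)
    rw [Finsupp.filter_add]
    exact ih _ _

theorem tirilmanNorm_nonneg (a : ℕ →₀ ℝ) : 0 ≤ tirilmanNorm p γ a :=
  Real.iSup_nonneg fun m => tirilmanNormAux_nonneg m a

theorem tirilmanNorm_smul (c : ℝ) (a : ℕ →₀ ℝ) :
    tirilmanNorm p γ (c • a) = |c| * tirilmanNorm p γ a := by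
  simp only [tirilmanNorm, tirilmanNormAux_smul]
  rw [Real.mul_iSup_of_nonneg (abs_nonneg c)]

theorem tirilmanNorm_add_le (hp : 1 < p) (h0 : 0 < γ) (h1 : γ < 1) (a b : ℕ →₀ ℝ) :
    tirilmanNorm p γ (a + b) ≤ tirilmanNorm p γ a + tirilmanNorm p γ b :=
  ciSup_le fun m => (tirilmanNormAux_add_le hp h0 h1 m a b).trans
    (add_le_add (tirilmanNormAux_le hp h0 h1 m a) (tirilmanNormAux_le hp h0 h1 m b))

theorem iSup_abs_le_tirilmanNorm (hp : 1 < p) (h0 : 0 < γ) (h1 : γ < 1) (a : ℕ →₀ ℝ) :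
    ⨆ i, |a i| ≤ tirilmanNorm p γ a :=
  tirilmanNormAux_le hp h0 h1 0 a

theorem tirilmanNorm_eq_zero_iff (hp : 1 < p) (h0 : 0 < γ) (h1 : γ < 1) (a : ℕ →₀ ℝ) :
    tirilmanNorm p γ a = 0 ↔ a = 0 := by
  constructor
  · intro h
    ext i
    have h2 := (le_ciSup (bddAbove_abs a) i).trans (iSup_abs_le_tirilmanNorm hp h0 h1 a)
    rw [h] at h2
    exact abs_nonpos_iff.1 h2
  · rintro rfl
    simpa using tirilmanNorm_smul (p := p) (γ := γ) 0 0

/-- The implicit equation, with a finite supremum. -/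
theorem tirilmanNorm_eq (hp : 1 < p) (h0 : 0 < γ) (h1 : γ < 1) (a : ℕ →₀ ℝ) :
    BddAbove (tirilmanAverages p (tirilmanNorm p γ) a) ∧
      tirilmanNorm p γ a =
        max (⨆ i, |a i|) (γ * sSup (tirilmanAverages p (tirilmanNorm p γ) a)) := by
  have hb := bddAbove_tirilmanAverages hp (tirilmanNorm_le_sum hp h0 h1) a
  refine ⟨hb, le_antisymm (ciSup_le fun m => ?_) (max_le ?_ ?_)⟩
  · induction m with
    | zero => exact le_max_left _ _
    | succ m ih =>
      refine max_le ih (le_max_of_le_right (mul_le_mul_of_nonneg_left ?_ h0.le))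
      refine csSup_le (tirilmanAverages_nonempty p _ _) ?_
      rintro r ⟨n, E, hn, hE, rfl⟩
      refine le_trans ?_ (le_csSup hb ⟨n, E, hn, hE, rfl⟩)
      exact div_le_div_of_nonneg_right
        (Finset.sum_le_sum fun j _ => tirilmanNormAux_le hp h0 h1 m _)
        (Real.rpow_nonneg (Nat.cast_nonneg n) _)
  · exact iSup_abs_le_tirilmanNorm hp h0 h1 a
  · rw [← le_div_iff₀' h0]
    refine csSup_le (tirilmanAverages_nonempty p _ _) ?_
    rintro r ⟨n, E, hn, hE, rfl⟩
    have ht : Tendsto (fun m => (∑ j, tirilmanNormAux p γ m (a.filter (· ∈ E j))) /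
        (n : ℝ) ^ (1 / Real.conjExponent p)) atTop
        (𝓝 ((∑ j, tirilmanNorm p γ (a.filter (· ∈ E j))) /
          (n : ℝ) ^ (1 / Real.conjExponent p))) :=
      (tendsto_finsetSum _ fun j _ => tendsto_tirilmanNormAux hp h0 h1 _).div_const _
    refine le_of_tendsto' ht fun m => ?_
    rw [le_div_iff₀' h0]
    refine le_trans ?_ (tirilmanNormAux_le hp h0 h1 (m + 1) a)
    refine le_max_of_le_right (mul_le_mul_of_nonneg_left (le_csSup ?_ ⟨n, E, hn, hE, rfl⟩) h0.le)
    exact bddAbove_tirilmanAverages hp (tirilmanNormAux_le_sum hp h0 h1 m) a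

/-- The implicit equation determines the norm. -/
theorem tirilmanNorm_unique (hp : 1 < p) (h0 : 0 < γ) (h1 : γ < 1) (N : Seminorm ℝ (ℕ →₀ ℝ))
    (hN : ∀ a, BddAbove (tirilmanAverages p N a) ∧
      N a = max (⨆ i, |a i|) (γ * sSup (tirilmanAverages p N a))) (a : ℕ →₀ ℝ) :
    N a = tirilmanNorm p γ a := by
  have key : ∀ N₁ N₂ : (ℕ →₀ ℝ) → ℝ, (∀ a, 0 ≤ N₁ a) → N₁ 0 = 0 →
      (∀ a, BddAbove (tirilmanAverages p N₁ a) ∧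
        N₁ a = max (⨆ i, |a i|) (γ * sSup (tirilmanAverages p N₁ a))) →
      (∀ a, BddAbove (tirilmanAverages p N₂ a) ∧
        N₂ a = max (⨆ i, |a i|) (γ * sSup (tirilmanAverages p N₂ a))) →
      ∀ a : ℕ →₀ ℝ, (∀ s : Finset ℕ, a.filter (· ∈ s) ≠ a →
        N₁ (a.filter (· ∈ s)) = N₂ (a.filter (· ∈ s))) → N₁ a ≤ N₂ a := by
    intro N₁ N₂ hpos hzero hN₁ hN₂ a hs
    have hle : γ * sSup (tirilmanAverages p N₁ a) ≤ max (N₂ a) (γ * N₁ a) := by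
      rw [← le_div_iff₀' h0]
      refine csSup_le (tirilmanAverages_nonempty p _ _) ?_
      rintro r ⟨n, E, hn, hE, rfl⟩
      rw [le_div_iff₀' h0]
      by_cases hj : ∃ j, a.filter (· ∈ E j) = a
      · obtain ⟨j, hj⟩ := hj
        refine le_max_of_le_right (mul_le_mul_of_nonneg_left ?_ h0.le)
        have hsum : ∑ i, N₁ (a.filter (· ∈ E i)) = N₁ a := by
          rw [Finset.sum_eq_single j, hj]
          · intro i _ hij
            have : a.filter (· ∈ E i) = 0 := by
              rw [← hj]
              ext x
              by_cases hx : x ∈ E i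
              · have hx' : x ∉ E j := Finset.disjoint_left.1 (hE.disjoint hij) hx
                simp [Finsupp.filter_apply, hx']
              · simp [hx]
            rw [this, hzero]
          · simp
        rw [hsum]
        exact div_le_self (hpos a) (one_le_rpow_conj hp hn)
      · push Not at hj
        refine le_max_of_le_left ?_
        rw [(hN₂ a).2]
        refine le_max_of_le_right (mul_le_mul_of_nonneg_left (le_csSup (hN₂ a).1 ?_) h0.le)
        exact ⟨n, E, hn, hE, by simp only [hs _ (hj _)]⟩
    have h2 : ⨆ i, |a i| ≤ N₂ a := by
      rw [(hN₂ a).2]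
      exact le_max_left _ _
    have h3 : N₁ a ≤ max (N₂ a) (γ * N₁ a) := by
      conv_lhs => rw [(hN₁ a).2]
      exact max_le (le_max_of_le_left h2) hle
    rcases le_max_iff.1 h3 with h | h
    · exact h
    · have h4 : N₁ a = 0 := le_antisymm (by nlinarith) (hpos a)
      rw [h4]
      exact (iSup_abs_nonneg a).trans h2
  induction hk : a.support.card using Nat.strong_induction_on generalizing a with
  | _ k ih =>
    have hs : ∀ s : Finset ℕ, a.filter (· ∈ s) ≠ a →
        N (a.filter (· ∈ s)) = tirilmanNorm p γ (a.filter (· ∈ s)) := by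
      intro s hne
      refine ih _ ?_ _ rfl
      rw [← hk, Finsupp.support_filter]
      refine Finset.card_lt_card (Finset.filter_ssubset.2 ?_)
      by_contra! hcon
      exact hne ((Finsupp.filter_eq_self_iff _ _).2 fun x hx =>
        hcon x (Finsupp.mem_support_iff.2 hx))
    exact le_antisymm
      (key _ _ (apply_nonneg N) (map_zero N) hN (tirilmanNorm_eq hp h0 h1) a hs)
      (key _ _ tirilmanNorm_nonneg ((tirilmanNorm_eq_zero_iff hp h0 h1 0).2 rfl)
        (tirilmanNorm_eq hp h0 h1) hN a fun s hne => (hs s hne).symm)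

end NormFacts

/-! ### The Tirilman space -/

/-- The space `c₀₀` of finitely supported real sequences with the norm of `Ti(p, γ)`. -/
def TirilmanFin (p γ : ℝ) (_ : 1 < p) (_ : 0 < γ) (_ : γ < 1) : Type :=
  ℕ →₀ ℝ

section Space

variable {p γ : ℝ} {hp : 1 < p} {h0 : 0 < γ} {h1 : γ < 1}

instance : AddCommGroup (TirilmanFin p γ hp h0 h1) :=
  inferInstanceAs (AddCommGroup (ℕ →₀ ℝ))

instance : Module ℝ (TirilmanFin p γ hp h0 h1) :=
  inferInstanceAs (Module ℝ (ℕ →₀ ℝ))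

instance : Norm (TirilmanFin p γ hp h0 h1) :=
  ⟨fun a => tirilmanNorm p γ a⟩

theorem TirilmanFin.core : NormedSpace.Core ℝ (TirilmanFin p γ hp h0 h1) where
  norm_nonneg a := tirilmanNorm_nonneg (p := p) (γ := γ) a
  norm_smul c a := tirilmanNorm_smul (p := p) (γ := γ) c a
  norm_triangle a b := tirilmanNorm_add_le hp h0 h1 a b
  norm_eq_zero_iff a := tirilmanNorm_eq_zero_iff hp h0 h1 a

instance : NormedAddCommGroup (TirilmanFin p γ hp h0 h1) :=
  NormedAddCommGroup.ofCore TirilmanFin.core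

instance : NormedSpace ℝ (TirilmanFin p γ hp h0 h1) :=
  NormedSpace.ofCore TirilmanFin.core

end Space

/-- The Tirilman space `Ti(p, γ)`, `1 < p < ∞`, `0 < γ < 1`. -/
abbrev Tirilman (p γ : ℝ) (hp : 1 < p) (h0 : 0 < γ) (h1 : γ < 1) : Type :=
  UniformSpace.Completion (TirilmanFin p γ hp h0 h1)

/-- The canonical basis `(eⱼ)` of `Ti(p, γ)`. -/
def tirilmanBasis (p γ : ℝ) (hp : 1 < p) (h0 : 0 < γ) (h1 : γ < 1) (j : ℕ) :
    Tirilman p γ hp h0 h1 :=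
  UniformSpace.Completion.toComplₗᵢ (𝕜 := ℝ) (E := TirilmanFin p γ hp h0 h1)
    (Finsupp.single j 1 : ℕ →₀ ℝ)

/-! ### Equivalent sequences and subsymmetric bases -/

/-- The series `∑ⱼ aⱼ xⱼ` converges: its partial sums have a limit. -/
def SeriesConverges {X : Type*} [NormedAddCommGroup X] [NormedSpace ℝ X]
    (x : ℕ → X) (a : ℕ → ℝ) : Prop :=
  ∃ s : X, Tendsto (fun n => ∑ j ∈ Finset.range n, a j • x j) atTop (𝓝 s)

/-- Two sequences, possibly in different spaces, are equivalent: `∑ⱼ aⱼ xⱼ` converges if and only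
if `∑ⱼ aⱼ yⱼ` converges. -/
def EquivalentSequences {X Y : Type*} [NormedAddCommGroup X] [NormedSpace ℝ X]
    [NormedAddCommGroup Y] [NormedSpace ℝ Y] (x : ℕ → X) (y : ℕ → Y) : Prop :=
  ∀ a : ℕ → ℝ, SeriesConverges x a ↔ SeriesConverges y a

/-- A (Schauder) basis is subsymmetric if it is unconditional (every convergent series
`∑ⱼ aⱼ bⱼ` converges unconditionally) and equivalent to all of its subsequences. -/
structure IsSubsymmetric {X : Type*} [NormedAddCommGroup X] [NormedSpace ℝ X]
    (b : SchauderBasis ℝ X) : Prop where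
  unconditional : ∀ a : ℕ → ℝ, SeriesConverges b a → Summable fun j => a j • b j
  subsequences : ∀ φ : ℕ → ℕ, StrictMono φ → EquivalentSequences b (b ∘ φ)

end

noncomputable section


/-! ### Restrictions of finitely supported sequences -/

/-! Write `q` for the conjugate exponent. Two estimates on successive pieces govern the space. The
implicit equation bounds a sum of `n` norms of successive restrictions by `n ^ (1/q) / γ` times the
norm (`sum_restr_le`), and for `γ ≤ 1/2` it also forces an upper `p`-estimate with constant 4
(`tirilmanNorm_sum_le`). By duality the unit vector basis is shrinking, and a functional with small
coordinates splits into few intervals of small norm (`exists_partition`).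

Let `b` be a subsymmetric basis of a quotient with quotient map `Q`. The functionals `b.coord j ∘ Q`
tend to zero pointwise, so by a gliding hump a subsequence `f k` of them is close to functionals
living on successive intervals (`exists_blockApprox`). Subsymmetry realizes the coefficients `a k`
of any convergent series in `b` as `f k x` for one vector `x`. Since the Tirilman norm is the least
one compatible with its recursion, `∑ f k x • e k` converges (`tirilmanNorm_sum_single_le`), so `b`
dominates the unit vectors.

For the converse, look at the coordinates of the `f k` on their intervals. If infinitely many `f k`
have a coordinate of size at least some `δ > 0`, the corresponding unit vectors behave as lifts of
basis vectors, and spreading and unconditionality show that the unit vectors dominate `b`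
(`seriesConverges_of_large_coordinates`).

Otherwise the coordinates tend uniformly to zero. Then the small pieces from `exists_partition` show
that `x ↦ (f k x)` takes values in `ℓ_p` (`summable_of_small_coordinates`). Restricted lifts of the
basis vectors form a block sequence with a lower `p`-estimate (`BlockApprox.exists_lower_estimate`).
For small `γ` this is impossible (`not_lower_estimate`): James' argument makes the lower constant
nearly stable on flat vectors. The sum of two successive flat vectors should then have norm about `2
^ (1/p)` times that of one of them. If the second is much flatter than the first, however, no family
of sets norms both well, and the sum is barely longer than one of them. -/

open Classical in
/-- The restriction `S a` of a finitely supported sequence `a` to a set `S`. -/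
def restr (S : Set ℕ) : (ℕ →₀ ℝ) →ₗ[ℝ] (ℕ →₀ ℝ) where
  toFun a := a.filter (· ∈ S)
  map_add' _ _ := Finsupp.filter_add
  map_smul' _ _ := Finsupp.filter_smul

theorem restr_of_mem {S : Set ℕ} {i : ℕ} (hi : i ∈ S) (a : ℕ →₀ ℝ) : restr S a i = a i := by
  classical exact Finsupp.filter_apply_pos _ _ hi

theorem restr_of_notMem {S : Set ℕ} {i : ℕ} (hi : i ∉ S) (a : ℕ →₀ ℝ) : restr S a i = 0 := by
  classical exact Finsupp.filter_apply_neg _ _ hi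

theorem mem_of_restr_ne_zero {S : Set ℕ} {i : ℕ} {a : ℕ →₀ ℝ} (h : restr S a i ≠ 0) : i ∈ S := by
  by_contra hi
  exact h (restr_of_notMem hi a)

theorem ne_zero_of_restr_ne_zero {S : Set ℕ} {i : ℕ} {a : ℕ →₀ ℝ} (h : restr S a i ≠ 0) :
    a i ≠ 0 := by
  rwa [restr_of_mem (mem_of_restr_ne_zero h)] at h

theorem filter_eq_restr (E : Finset ℕ) (a : ℕ →₀ ℝ) : a.filter (· ∈ E) = restr (E : Set ℕ) a := by
  ext i
  by_cases hi : i ∈ E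
  · rw [Finsupp.filter_apply_pos _ _ hi, restr_of_mem (by exact_mod_cast hi)]
  · rw [Finsupp.filter_apply_neg _ _ hi, restr_of_notMem (by exact_mod_cast hi)]

theorem abs_restr_le (S : Set ℕ) (a : ℕ →₀ ℝ) (i : ℕ) : |restr S a i| ≤ |a i| := by
  by_cases hi : i ∈ S
  · rw [restr_of_mem hi]
  · rw [restr_of_notMem hi, abs_zero]; exact abs_nonneg _

theorem restr_restr (S T : Set ℕ) (a : ℕ →₀ ℝ) : restr S (restr T a) = restr (S ∩ T) a := by
  ext i
  by_cases hS : i ∈ S <;> by_cases hT : i ∈ T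
  · rw [restr_of_mem hS, restr_of_mem hT, restr_of_mem (⟨hS, hT⟩ : i ∈ S ∩ T)]
  · rw [restr_of_mem hS, restr_of_notMem hT, restr_of_notMem fun h : i ∈ S ∩ T => hT h.2]
  · rw [restr_of_notMem hS, restr_of_notMem fun h : i ∈ S ∩ T => hS h.1]
  · rw [restr_of_notMem hS, restr_of_notMem fun h : i ∈ S ∩ T => hS h.1]

theorem restr_eq_self {S : Set ℕ} {a : ℕ →₀ ℝ} (h : ∀ i, a i ≠ 0 → i ∈ S) : restr S a = a := by
  ext i
  by_cases hi : i ∈ S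
  · exact restr_of_mem hi a
  · rw [restr_of_notMem hi]
    by_contra h'
    exact hi (h i (Ne.symm h'))

/-- A family of sets, some of them possibly empty, with `x < y` for `x ∈ S i`, `y ∈ S j` and
`i < j`. -/
def SuccessiveSets {ι : Type*} [LT ι] (S : ι → Set ℕ) : Prop :=
  ∀ i j, i < j → ∀ x ∈ S i, ∀ y ∈ S j, x < y

theorem IsSuccessive.successiveSets {n : ℕ} {E : Fin n → Finset ℕ} (hE : IsSuccessive E) :
    SuccessiveSets fun i => (E i : Set ℕ) :=
  fun i j hij x hx y hy => hE.2 i j hij x hx y hy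

variable {p γ : ℝ}

/-! ### Averages over arbitrary successive sets -/

/-- Replacing each set by the support of the restriction, and dropping the zero restrictions,
produces an admissible family with at most as many members. Allowing empty and infinite sets,
indexed by any linear order, makes preimages, unions and lexicographic families usable later. -/
theorem sum_restr_le_sSup (hp : 1 < p) {Nf : (ℕ →₀ ℝ) → ℝ} (hN : ∀ a, 0 ≤ Nf a) (hN0 : Nf 0 = 0)
    {a : ℕ →₀ ℝ} (hb : BddAbove (tirilmanAverages p Nf a)) {ι : Type*} [LinearOrder ι]
    (s : Finset ι) {S : ι → Set ℕ} (hS : SuccessiveSets S) :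
    ∑ i ∈ s, Nf (restr (S i) a) ≤
      (s.card : ℝ) ^ (1 / p.conjExponent) * sSup (tirilmanAverages p Nf a) := by
  classical
  have hq : 0 ≤ 1 / p.conjExponent := by
    unfold Real.conjExponent
    have : 0 < p - 1 := by linarith
    positivity
  have hsup : 0 ≤ sSup (tirilmanAverages p Nf a) :=
    Real.sSup_nonneg (tirilmanAverages_nonneg hN a)
  set t := s.filter fun i => restr (S i) a ≠ 0 with ht
  have hst : ∑ i ∈ s, Nf (restr (S i) a) = ∑ i ∈ t, Nf (restr (S i) a) := by
    refine (Finset.sum_subset (Finset.filter_subset _ _) fun i hi hit => ?_).symm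
    have : restr (S i) a = 0 := by
      by_contra h
      exact hit (Finset.mem_filter.2 ⟨hi, h⟩)
    rw [this, hN0]
  rw [hst]
  rcases Nat.eq_zero_or_pos t.card with h0 | hpos
  · rw [Finset.card_eq_zero.1 h0, Finset.sum_empty]
    positivity
  let e := t.orderEmbOfFin rfl
  let E : Fin t.card → Finset ℕ := fun j => (restr (S (e j)) a).support
  have hEi : ∀ j x, x ∈ E j → x ∈ S (e j) := fun j x hx =>
    mem_of_restr_ne_zero (Finsupp.mem_support_iff.1 hx)
  have hE : IsSuccessive E := by
    refine ⟨fun j => ?_, fun i j hij x hx y hy => ?_⟩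
    · rw [Finsupp.support_nonempty_iff]
      exact (Finset.mem_filter.1 (t.orderEmbOfFin_mem rfl j)).2
    · exact hS _ _ (e.strictMono hij) x (hEi _ _ hx) y (hEi _ _ hy)
  have hr : ∀ j, a.filter (· ∈ E j) = restr (S (e j)) a := by
    intro j
    rw [filter_eq_restr]
    ext x
    by_cases hx : x ∈ E j
    · rw [restr_of_mem (by exact_mod_cast hx), restr_of_mem (hEi j x hx)]
    · rw [restr_of_notMem (by exact_mod_cast hx)]
      exact (Finsupp.notMem_support_iff.1 hx).symm
  have hsum : ∑ i ∈ t, Nf (restr (S i) a) = ∑ j, Nf (a.filter (· ∈ E j)) := by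
    simp only [hr]
    rw [← Finset.sum_image (s := Finset.univ) (g := e) (f := fun i => Nf (restr (S i) a))
      (fun x _ y _ h => e.injective h)]
    congr 1
    exact (Finset.image_orderEmbOfFin_univ t rfl).symm
  have hle := le_csSup hb ⟨t.card, E, hpos, hE, rfl⟩
  rw [div_le_iff₀ (Real.rpow_pos_of_pos (by exact_mod_cast hpos) _), ← hsum] at hle
  refine hle.trans ?_
  rw [mul_comm]
  refine mul_le_mul_of_nonneg_right (Real.rpow_le_rpow (Nat.cast_nonneg _) ?_ hq) hsup
  exact_mod_cast Finset.card_le_card (Finset.filter_subset _ _)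

theorem tirilmanNormAux_zero (m : ℕ) : tirilmanNormAux p γ m 0 = 0 := by
  simpa using tirilmanNormAux_smul (p := p) (γ := γ) m 0 0

theorem tirilmanNorm_zero : tirilmanNorm p γ 0 = 0 := by
  simpa using tirilmanNorm_smul (p := p) (γ := γ) 0 0

theorem sum_restr_le_aux (hp : 1 < p) (h0 : 0 < γ) (h1 : γ < 1) (m : ℕ) (a : ℕ →₀ ℝ)
    {ι : Type*} [LinearOrder ι] (s : Finset ι) {S : ι → Set ℕ} (hS : SuccessiveSets S) :
    γ * ∑ i ∈ s, tirilmanNormAux p γ m (restr (S i) a) ≤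
      (s.card : ℝ) ^ (1 / p.conjExponent) * tirilmanNormAux p γ (m + 1) a := by
  have h := sum_restr_le_sSup hp (tirilmanNormAux_nonneg m) (tirilmanNormAux_zero (γ := γ) m)
    (bddAbove_tirilmanAverages hp (tirilmanNormAux_le_sum hp h0 h1 m) a) s hS
  calc _ ≤ γ * _ := mul_le_mul_of_nonneg_left h h0.le
    _ = (s.card : ℝ) ^ (1 / p.conjExponent) *
      (γ * sSup (tirilmanAverages p (tirilmanNormAux p γ m) a)) := by ring
    _ ≤ _ := mul_le_mul_of_nonneg_left (le_max_right _ _) (by positivity)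

theorem sum_restr_le (hp : 1 < p) (h0 : 0 < γ) (h1 : γ < 1) (a : ℕ →₀ ℝ)
    {ι : Type*} [LinearOrder ι] (s : Finset ι) {S : ι → Set ℕ} (hS : SuccessiveSets S) :
    γ * ∑ i ∈ s, tirilmanNorm p γ (restr (S i) a) ≤
      (s.card : ℝ) ^ (1 / p.conjExponent) * tirilmanNorm p γ a := by
  have h := sum_restr_le_sSup hp tirilmanNorm_nonneg (tirilmanNorm_zero (p := p) (γ := γ))
    (tirilmanNorm_eq hp h0 h1 a).1 s hS
  calc _ ≤ γ * _ := mul_le_mul_of_nonneg_left h h0.le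
    _ = (s.card : ℝ) ^ (1 / p.conjExponent) *
      (γ * sSup (tirilmanAverages p (tirilmanNorm p γ) a)) := by ring
    _ ≤ _ := by
      refine mul_le_mul_of_nonneg_left ?_ (by positivity)
      rw [(tirilmanNorm_eq hp h0 h1 a).2]
      exact le_max_right _ _

theorem mul_sSup_averages_le (h0 : 0 < γ) {Nf : (ℕ →₀ ℝ) → ℝ} {a : ℕ →₀ ℝ} {B : ℝ}
    (hB : ∀ n (E : Fin n → Finset ℕ), 0 < n → IsSuccessive E →
      γ * ∑ i, Nf (restr (E i) a) ≤ (n : ℝ) ^ (1 / p.conjExponent) * B) :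
    γ * sSup (tirilmanAverages p Nf a) ≤ B := by
  rw [← le_div_iff₀' h0]
  refine csSup_le (tirilmanAverages_nonempty p _ a) ?_
  rintro r ⟨n, E, hn, hE, rfl⟩
  rw [div_le_div_iff₀ (Real.rpow_pos_of_pos (by exact_mod_cast hn) _) h0]
  have := hB n E hn hE
  simp only [filter_eq_restr]
  linarith

/-- A bound for the norms of the recursive sequence. -/
theorem tirilmanNormAux_succ_le (h0 : 0 < γ) {m : ℕ} {a : ℕ →₀ ℝ} {B : ℝ}
    (ha : tirilmanNormAux p γ m a ≤ B)
    (hB : ∀ n (E : Fin n → Finset ℕ), 0 < n → IsSuccessive E →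
      γ * ∑ i, tirilmanNormAux p γ m (restr (E i) a) ≤ (n : ℝ) ^ (1 / p.conjExponent) * B) :
    tirilmanNormAux p γ (m + 1) a ≤ B :=
  max_le ha (mul_sSup_averages_le h0 hB)

theorem tirilmanNorm_le (hp : 1 < p) (h0 : 0 < γ) (h1 : γ < 1) {a : ℕ →₀ ℝ} {B : ℝ}
    (ha : ∀ i, |a i| ≤ B)
    (hB : ∀ n (E : Fin n → Finset ℕ), 0 < n → IsSuccessive E →
      γ * ∑ i, tirilmanNorm p γ (restr (E i) a) ≤ (n : ℝ) ^ (1 / p.conjExponent) * B) :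
    tirilmanNorm p γ a ≤ B := by
  rw [(tirilmanNorm_eq hp h0 h1 a).2]
  exact max_le (ciSup_le ha) (mul_sSup_averages_le h0 hB)

theorem abs_apply_le_tirilmanNorm (hp : 1 < p) (h0 : 0 < γ) (h1 : γ < 1) (a : ℕ →₀ ℝ) (i : ℕ) :
    |a i| ≤ tirilmanNorm p γ a :=
  (le_ciSup (bddAbove_abs a) i).trans (iSup_abs_le_tirilmanNorm hp h0 h1 a)

/-! ### Unconditionality and spreading -/

/-- Sets used to average `b` pull back along `φ` to successive, possibly empty, sets for `a`. The
case `φ = id` is lattice monotonicity, hence unconditionality; general `φ` is the spreading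
property. -/
theorem tirilmanNormAux_le_of_spread (hp : 1 < p) (h0 : 0 < γ) (h1 : γ < 1) {φ : ℕ → ℕ}
    (hφ : StrictMono φ) (m : ℕ) : ∀ a b : ℕ →₀ ℝ,
    (∀ i, b i ≠ 0 → ∃ k, φ k = i ∧ |b i| ≤ |a k|) →
      tirilmanNormAux p γ m b ≤ tirilmanNormAux p γ m a := by
  induction m with
  | zero =>
    intro a b hab
    refine ciSup_le fun i => ?_
    by_cases hi : b i = 0
    · rw [hi, abs_zero]; exact iSup_abs_nonneg a
    · obtain ⟨k, -, hk⟩ := hab i hi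
      exact hk.trans (le_ciSup (bddAbove_abs a) k)
  | succ m ih =>
    intro a b hab
    refine tirilmanNormAux_succ_le h0 ((ih a b hab).trans (tirilmanNormAux_mono a m.le_succ)) ?_
    intro n E hn hE
    have hS : SuccessiveSets fun i : Fin n => φ ⁻¹' (E i : Set ℕ) := fun i j hij x hx y hy =>
      hφ.lt_iff_lt.1 (hE.2 i j hij _ hx _ hy)
    refine le_trans (mul_le_mul_of_nonneg_left (Finset.sum_le_sum fun i _ => ?_) h0.le)
      ((sum_restr_le_aux hp h0 h1 m a Finset.univ hS).trans_eq (by simp))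
    refine ih _ _ fun x hx => ?_
    obtain ⟨k, rfl, hk⟩ := hab x (ne_zero_of_restr_ne_zero hx)
    have hm := mem_of_restr_ne_zero hx
    refine ⟨k, rfl, ?_⟩
    rw [restr_of_mem hm, restr_of_mem (by exact hm)]
    exact hk

theorem tirilmanNorm_le_of_spread (hp : 1 < p) (h0 : 0 < γ) (h1 : γ < 1) {φ : ℕ → ℕ}
    (hφ : StrictMono φ) {a b : ℕ →₀ ℝ} (hab : ∀ i, b i ≠ 0 → ∃ k, φ k = i ∧ |b i| ≤ |a k|) :
    tirilmanNorm p γ b ≤ tirilmanNorm p γ a :=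
  ciSup_le fun m => (tirilmanNormAux_le_of_spread hp h0 h1 hφ m a b hab).trans
    (tirilmanNormAux_le hp h0 h1 m a)

theorem tirilmanNorm_restr_le (hp : 1 < p) (h0 : 0 < γ) (h1 : γ < 1) (S : Set ℕ) (a : ℕ →₀ ℝ) :
    tirilmanNorm p γ (restr S a) ≤ tirilmanNorm p γ a :=
  tirilmanNorm_le_of_spread hp h0 h1 strictMono_id fun i _ => ⟨i, rfl, abs_restr_le S a i⟩

/-! ### Cutting block sequences -/

/-- The supports of the vectors `x i` are successive. -/
def SuccessiveBlocks (x : ℕ → ℕ →₀ ℝ) : Prop :=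
  ∀ i j, i < j → ∀ k, x i k ≠ 0 → ∀ l, x j l ≠ 0 → k < l

theorem SuccessiveBlocks.restr {x : ℕ → ℕ →₀ ℝ} (hx : SuccessiveBlocks x) (S : ℕ → Set ℕ) :
    SuccessiveBlocks fun j => restr (S j) (x j) := fun i j hij k hk l hl =>
  hx i j hij k (ne_zero_of_restr_ne_zero hk) l (ne_zero_of_restr_ne_zero hl)

open Classical in
/-- The indices of the sets which meet the support of a vector. -/
def meeting {n : ℕ} (E : Fin n → Finset ℕ) (a : ℕ →₀ ℝ) : Finset (Fin n) :=
  Finset.univ.filter fun i => restr (E i) a ≠ 0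

theorem mem_meeting {n : ℕ} {E : Fin n → Finset ℕ} {a : ℕ →₀ ℝ} {i : Fin n} :
    i ∈ meeting E a ↔ ∃ k ∈ E i, a k ≠ 0 := by
  simp only [meeting, Finset.mem_filter, Finset.mem_univ, true_and]
  constructor
  · intro h
    obtain ⟨k, hk⟩ := Finsupp.ne_iff.1 h
    exact ⟨k, mem_of_restr_ne_zero hk, ne_zero_of_restr_ne_zero hk⟩
  · rintro ⟨k, hk, hak⟩ h
    have := DFunLike.congr_fun h k
    rw [restr_of_mem (by exact_mod_cast hk)] at this
    exact hak this

theorem restr_eq_zero_of_notMem_meeting {n : ℕ} {E : Fin n → Finset ℕ} {a : ℕ →₀ ℝ} {i : Fin n}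
    (h : i ∉ meeting E a) : restr (E i) a = 0 := by
  by_contra h'
  exact h (by simpa [meeting] using h')

/-- Discard from each block the first set which it meets. A set cannot survive for two blocks: it
would meet the earlier block, while a set to its left meets the later one. So at most `n` incidences
survive, and with at least two incidences per block discarding keeps at least half. -/
theorem sum_card_meeting_le {n : ℕ} {E : Fin n → Finset ℕ} (hE : IsSuccessive E)
    {x : ℕ → ℕ →₀ ℝ} (hx : SuccessiveBlocks x) {s : Finset ℕ}
    (hs : ∀ j ∈ s, 2 ≤ (meeting E (x j)).card) : ∑ j ∈ s, (meeting E (x j)).card ≤ 2 * n := by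
  classical
  let F : ℕ → Finset (Fin n) := fun j =>
    (meeting E (x j)).filter fun i => ∃ i₀ ∈ meeting E (x j), i₀ < i
  have h1 : ∀ j ∈ s, (meeting E (x j)).card ≤ 2 * (F j).card := by
    intro j hj
    have h := Finset.card_filter_add_card_filter_not (s := meeting E (x j))
      (fun i => ∃ i₀ ∈ meeting E (x j), i₀ < i)
    have h2 : ((meeting E (x j)).filter fun i => ¬ ∃ i₀ ∈ meeting E (x j), i₀ < i).card ≤ 1 := by
      refine Finset.card_le_one.2 fun a ha b hb => ?_
      rw [Finset.mem_filter] at ha hb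
      refine le_antisymm (not_lt.1 fun h => ha.2 ⟨b, hb.1, h⟩)
        (not_lt.1 fun h => hb.2 ⟨a, ha.1, h⟩)
    have := hs j hj
    change (F j).card + _ = _ at h
    omega
  have hlt : ∀ j j', j < j' → Disjoint (F j) (F j') := by
    intro j j' hjj
    refine Finset.disjoint_left.2 fun i hi hi' => ?_
    obtain ⟨k, hk, hxk⟩ := mem_meeting.1 (Finset.mem_filter.1 hi).1
    obtain ⟨i₀, hi₀, hlt⟩ := (Finset.mem_filter.1 hi').2
    obtain ⟨l, hl, hxl⟩ := mem_meeting.1 hi₀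
    exact lt_asymm (hx j j' hjj k hxk l hxl) (hE.2 i₀ i hlt l hl k hk)
  have h2 : ∑ j ∈ s, (F j).card ≤ n := by
    rw [← Finset.card_biUnion]
    · exact (Finset.card_le_univ _).trans_eq (Fintype.card_fin n)
    · intro j _ j' _ hne
      rcases lt_or_gt_of_ne hne with h | h
      · exact hlt _ _ h
      · exact (hlt _ _ h).symm
  calc _ ≤ ∑ j ∈ s, 2 * (F j).card := Finset.sum_le_sum h1
    _ = 2 * ∑ j ∈ s, (F j).card := by rw [Finset.mul_sum]
    _ ≤ _ := by omega

/-- The members of a finite family of blocks which meet at least two of the sets `E i`. -/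
def edgeBlocks {n : ℕ} (E : Fin n → Finset ℕ) (x : ℕ → ℕ →₀ ℝ) (s : Finset ℕ) : Finset ℕ :=
  s.filter fun j => 2 ≤ (meeting E (x j)).card

theorem apply_sum_le {Nf : (ℕ →₀ ℝ) → ℝ} (hN0 : Nf 0 = 0)
    (hadd : ∀ a b, Nf (a + b) ≤ Nf a + Nf b) {ι : Type*} (s : Finset ι) (f : ι → ℕ →₀ ℝ) :
    Nf (∑ i ∈ s, f i) ≤ ∑ i ∈ s, Nf (f i) :=
  Finset.le_sum_of_subadditive Nf hN0.le hadd s f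

/-- Hölder's inequality for a sum of `n` terms. -/
theorem sum_rpow_le (hp : 1 < p) {ι : Type*} (s : Finset ι) {f : ι → ℝ} (hf : ∀ i ∈ s, 0 ≤ f i) :
    ∑ i ∈ s, f i ^ (1 / p) ≤ (s.card : ℝ) ^ (1 / p.conjExponent) * (∑ i ∈ s, f i) ^ (1 / p) := by
  have h := Real.inner_le_Lp_mul_Lq_of_nonneg s (f := fun i => f i ^ (1 / p)) (g := fun _ => 1)
    (Real.HolderConjugate.conjExponent hp) (fun i hi => Real.rpow_nonneg (hf i hi) _)
    (fun _ _ => zero_le_one)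
  simp only [mul_one, Real.one_rpow, Finset.sum_const, nsmul_eq_mul] at h
  rw [mul_comm]
  refine h.trans_eq ?_
  congr 2
  refine Finset.sum_congr rfl fun i hi => ?_
  rw [← Real.rpow_mul (hf i hi), one_div_mul_cancel (by linarith), Real.rpow_one]

/-- The blocks which meet only one of the sets `E i`. -/
theorem sum_interior_le (hp : 1 < p) (h0 : 0 < γ) (h1 : γ < 1) {n : ℕ} (E : Fin n → Finset ℕ)
    (x : ℕ → ℕ →₀ ℝ) (s : Finset ℕ) :
    ∑ i, (∑ j ∈ s \ edgeBlocks E x s, tirilmanNorm p γ (restr (E i) (x j)) ^ p) ^ (1 / p) ≤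
      (n : ℝ) ^ (1 / p.conjExponent) * (∑ j ∈ s, tirilmanNorm p γ (x j) ^ p) ^ (1 / p) := by
  have hp0 : 0 < p := by linarith
  have hnn : ∀ a, 0 ≤ tirilmanNorm p γ a ^ p := fun a => Real.rpow_nonneg (tirilmanNorm_nonneg a) _
  -- Hölder over the `n` sets produces the factor `n ^ (1/q)`; after exchanging the sums, each block
  -- is counted at most once.
  refine (sum_rpow_le hp Finset.univ fun i _ => Finset.sum_nonneg fun j _ => hnn _).trans ?_
  rw [Finset.card_univ, Fintype.card_fin]
  refine mul_le_mul_of_nonneg_left (Real.rpow_le_rpow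
    (Finset.sum_nonneg fun i _ => Finset.sum_nonneg fun j _ => hnn _) ?_ (by positivity))
    (by positivity)
  rw [Finset.sum_comm]
  refine le_trans (Finset.sum_le_sum fun j hj => ?_)
    (Finset.sum_le_sum_of_subset_of_nonneg Finset.sdiff_subset fun j _ _ => hnn _)
  have hcard : (meeting E (x j)).card ≤ 1 := by
    rw [Finset.mem_sdiff, edgeBlocks, Finset.mem_filter, not_and, not_le] at hj
    exact Nat.le_of_lt_succ (hj.2 hj.1)
  have hz : ∀ i, i ∉ meeting E (x j) → tirilmanNorm p γ (restr (E i) (x j)) ^ p = 0 := by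
    intro i hi
    rw [restr_eq_zero_of_notMem_meeting hi, tirilmanNorm_zero, Real.zero_rpow hp0.ne']
  rw [← Finset.sum_subset (Finset.subset_univ (meeting E (x j))) fun i _ hi => hz i hi]
  calc _ ≤ ∑ i ∈ meeting E (x j), tirilmanNorm p γ (x j) ^ p :=
        Finset.sum_le_sum fun i _ => Real.rpow_le_rpow (tirilmanNorm_nonneg _)
          (tirilmanNorm_restr_le hp h0 h1 _ _) hp0.le
    _ = (meeting E (x j)).card * tirilmanNorm p γ (x j) ^ p := by
        rw [Finset.sum_const, nsmul_eq_mul]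
    _ ≤ 1 * tirilmanNorm p γ (x j) ^ p :=
        mul_le_mul_of_nonneg_right (by exact_mod_cast hcard) (hnn _)
    _ = _ := one_mul _

/-- Blocks inside essentially one set are kept together, so that an upper estimate can be applied in
each set; blocks cut by several sets are separated by the triangle inequality. -/
theorem sum_restr_sum_le {Nf : (ℕ →₀ ℝ) → ℝ} (hN0 : Nf 0 = 0)
    (hadd : ∀ a b, Nf (a + b) ≤ Nf a + Nf b) {n : ℕ} (E : Fin n → Finset ℕ)
    (x : ℕ → ℕ →₀ ℝ) (s : Finset ℕ) :
    ∑ i, Nf (restr (E i) (∑ j ∈ s, x j)) ≤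
      ∑ i, Nf (∑ j ∈ s \ edgeBlocks E x s, restr (E i) (x j)) +
        ∑ j ∈ edgeBlocks E x s, ∑ i ∈ meeting E (x j), Nf (restr (E i) (x j)) := by
  have hz : ∀ j, ∑ i ∈ meeting E (x j), Nf (restr (E i) (x j)) = ∑ i, Nf (restr (E i) (x j)) :=
    fun j => Finset.sum_subset (Finset.subset_univ _) fun i _ hi => by
      rw [restr_eq_zero_of_notMem_meeting hi, hN0]
  simp only [hz]
  rw [Finset.sum_comm (s := edgeBlocks E x s), ← Finset.sum_add_distrib]
  refine Finset.sum_le_sum fun i _ => ?_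
  rw [map_sum, ← Finset.sum_sdiff (Finset.filter_subset _ s : edgeBlocks E x s ⊆ s)]
  exact (hadd _ _).trans (add_le_add_right (apply_sum_le hN0 hadd _ _) _)

/-- The blocks which meet several of the sets `E i`. -/
theorem sum_edge_le (hp : 1 < p) {n : ℕ} {E : Fin n → Finset ℕ} (hE : IsSuccessive E)
    {x : ℕ → ℕ →₀ ℝ} (hx : SuccessiveBlocks x) (s : Finset ℕ) :
    ∑ j ∈ edgeBlocks E x s, tirilmanNorm p γ (x j) *
        ((meeting E (x j)).card : ℝ) ^ (1 / p.conjExponent) ≤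
      2 * (n : ℝ) ^ (1 / p.conjExponent) * (∑ j ∈ s, tirilmanNorm p γ (x j) ^ p) ^ (1 / p) := by
  have hp0 : 0 < p := by linarith
  have hq := Real.HolderConjugate.conjExponent hp
  have hq0 := hq.symm.pos
  have hnn : ∀ a, 0 ≤ tirilmanNorm p γ a ^ p := fun a => Real.rpow_nonneg (tirilmanNorm_nonneg a) _
  set B := edgeBlocks E x s with hB
  have hc : ∑ j ∈ B, (meeting E (x j)).card ≤ 2 * n :=
    sum_card_meeting_le hE hx fun j hj => (Finset.mem_filter.1 hj).2
  have hR : 0 ≤ (∑ j ∈ s, tirilmanNorm p γ (x j) ^ p) ^ (1 / p) :=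
    Real.rpow_nonneg (Finset.sum_nonneg fun j _ => hnn _) _
  have hle : (∑ j ∈ B, tirilmanNorm p γ (x j) ^ p) ^ (1 / p) ≤
      (∑ j ∈ s, tirilmanNorm p γ (x j) ^ p) ^ (1 / p) :=
    Real.rpow_le_rpow (Finset.sum_nonneg fun j _ => hnn _)
      (Finset.sum_le_sum_of_subset_of_nonneg (Finset.filter_subset _ _) fun j _ _ => hnn _)
      (by positivity)
  have hcard : ∑ j ∈ B, (((meeting E (x j)).card : ℝ) ^ (1 / p.conjExponent)) ^ p.conjExponent ≤
      2 * (n : ℝ) := by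
    refine le_trans (le_of_eq ?_) (by exact_mod_cast hc : ∑ j ∈ B, ((meeting E (x j)).card : ℝ) ≤ _)
    refine Finset.sum_congr rfl fun j _ => ?_
    rw [← Real.rpow_mul (Nat.cast_nonneg _), one_div_mul_cancel hq0.ne', Real.rpow_one]
  have hq1 : 1 / p.conjExponent ≤ 1 := by
    rw [div_le_one hq0]
    exact hq.symm.lt.le
  have h2 : (2 : ℝ) ^ (1 / p.conjExponent) ≤ 2 := by
    conv_rhs => rw [← Real.rpow_one 2]
    exact Real.rpow_le_rpow_of_exponent_le (by norm_num) hq1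
  have hroot : (∑ j ∈ B, (((meeting E (x j)).card : ℝ) ^ (1 / p.conjExponent)) ^
      p.conjExponent) ^ (1 / p.conjExponent) ≤ 2 * (n : ℝ) ^ (1 / p.conjExponent) := by
    refine (Real.rpow_le_rpow (Finset.sum_nonneg fun j _ => Real.rpow_nonneg
      (Real.rpow_nonneg (Nat.cast_nonneg _) _) _) hcard (one_div_nonneg.2 hq0.le)).trans ?_
    rw [Real.mul_rpow zero_le_two (Nat.cast_nonneg n)]
    exact mul_le_mul_of_nonneg_right h2 (Real.rpow_nonneg (Nat.cast_nonneg n) _)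
  -- Hölder over the blocks this time: the incidence numbers sum to at most `2 * n`, and `2 ^ (1/q)
  -- ≤ 2`.
  refine (Real.inner_le_Lp_mul_Lq_of_nonneg B hq (fun j _ => tirilmanNorm_nonneg _)
    (fun j _ => Real.rpow_nonneg (Nat.cast_nonneg _) _)).trans ?_
  rw [mul_comm]
  exact mul_le_mul hroot hle (Real.rpow_nonneg (Finset.sum_nonneg fun j _ => hnn _) _)
    (mul_nonneg zero_le_two (Real.rpow_nonneg (Nat.cast_nonneg n) _))

/-! ### The upper `p`-estimate -/

/-- The constant 4 reproduces itself under the recursion: uncut blocks contribute `4 * γ ≤ 2` by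
induction, and cut blocks contribute 2, because for them `γ` is absorbed by the implicit equation of
each block. The right side carries the full norm so that this absorption is available at every
stage. -/
theorem tirilmanNormAux_sum_le (hp : 1 < p) (h0 : 0 < γ) (h1 : γ ≤ 1 / 2) (m : ℕ) :
    ∀ (x : ℕ → ℕ →₀ ℝ), SuccessiveBlocks x → ∀ s : Finset ℕ,
      tirilmanNormAux p γ m (∑ j ∈ s, x j) ≤
        4 * (∑ j ∈ s, tirilmanNorm p γ (x j) ^ p) ^ (1 / p) := by
  have h1' : γ < 1 := by linarith
  have hp0 : 0 < p := by linarith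
  have hnn : ∀ a, 0 ≤ tirilmanNorm p γ a ^ p := fun a => Real.rpow_nonneg (tirilmanNorm_nonneg a) _
  induction m with
  | zero =>
    intro x hx s
    have hR : 0 ≤ (∑ j ∈ s, tirilmanNorm p γ (x j) ^ p) ^ (1 / p) :=
      Real.rpow_nonneg (Finset.sum_nonneg fun j _ => hnn _) _
    refine ciSup_le fun k => ?_
    rw [Finsupp.finsetSum_apply]
    by_cases hk : ∃ j ∈ s, x j k ≠ 0
    · obtain ⟨j, hj, hjk⟩ := hk
      rw [Finset.sum_eq_single j]
      · have h2 : tirilmanNorm p γ (x j) ≤ (∑ j ∈ s, tirilmanNorm p γ (x j) ^ p) ^ (1 / p) := by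
          rw [one_div, Real.le_rpow_inv_iff_of_pos (tirilmanNorm_nonneg _)
            (Finset.sum_nonneg fun j _ => hnn _) hp0]
          exact Finset.single_le_sum (f := fun j => tirilmanNorm p γ (x j) ^ p)
            (fun j _ => hnn _) hj
        linarith [abs_apply_le_tirilmanNorm hp h0 h1' (x j) k]
      · intro i _ hij
        by_contra hik
        rcases lt_or_gt_of_ne hij with h | h
        · exact lt_irrefl _ (hx _ _ h k hik k hjk)
        · exact lt_irrefl _ (hx _ _ h k hjk k hik)
      · exact fun h => absurd hj h
    · push Not at hk
      rw [Finset.sum_eq_zero hk, abs_zero]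
      positivity
  | succ m ih =>
    intro x hx s
    set R := (∑ j ∈ s, tirilmanNorm p γ (x j) ^ p) ^ (1 / p) with hRdef
    have hR : 0 ≤ R := Real.rpow_nonneg (Finset.sum_nonneg fun j _ => hnn _) _
    refine tirilmanNormAux_succ_le h0 (ih x hx s) fun n E hn hE => ?_
    have hA := sum_restr_sum_le (Nf := tirilmanNormAux p γ m) (tirilmanNormAux_zero m)
      (tirilmanNormAux_add_le hp h0 h1' m) E x s
    set B := edgeBlocks E x s
    have hI : ∑ i, tirilmanNormAux p γ m (∑ j ∈ s \ B, restr (E i) (x j)) ≤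
        4 * ((n : ℝ) ^ (1 / p.conjExponent) * R) := by
      calc _ ≤ ∑ i, 4 * (∑ j ∈ s \ B, tirilmanNorm p γ (restr (E i) (x j)) ^ p) ^ (1 / p) :=
            Finset.sum_le_sum fun i _ => ih _ (hx.restr fun _ => E i) _
        _ = 4 * ∑ i, (∑ j ∈ s \ B, tirilmanNorm p γ (restr (E i) (x j)) ^ p) ^ (1 / p) := by
            rw [Finset.mul_sum]
        _ ≤ _ := mul_le_mul_of_nonneg_left (sum_interior_le hp h0 h1' E x s) (by norm_num)
    have hII : γ * ∑ j ∈ B, ∑ i ∈ meeting E (x j), tirilmanNormAux p γ m (restr (E i) (x j)) ≤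
        2 * (n : ℝ) ^ (1 / p.conjExponent) * R := by
      calc _ = ∑ j ∈ B, γ * ∑ i ∈ meeting E (x j), tirilmanNormAux p γ m (restr (E i) (x j)) := by
            rw [Finset.mul_sum]
        _ ≤ ∑ j ∈ B, tirilmanNorm p γ (x j) *
            ((meeting E (x j)).card : ℝ) ^ (1 / p.conjExponent) := by
            refine Finset.sum_le_sum fun j _ => ?_
            rw [mul_comm (tirilmanNorm p γ (x j))]
            exact (sum_restr_le_aux hp h0 h1' m (x j) _ hE.successiveSets).trans
              (mul_le_mul_of_nonneg_left (tirilmanNormAux_le hp h0 h1' _ _) (by positivity))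
        _ ≤ _ := sum_edge_le hp hE hx s
    have hnR : 0 ≤ (n : ℝ) ^ (1 / p.conjExponent) * R := by positivity
    have hI' := mul_le_mul_of_nonneg_left hI h0.le
    have hA' := mul_le_mul_of_nonneg_left hA h0.le
    nlinarith

theorem tirilmanNorm_sum_le (hp : 1 < p) (h0 : 0 < γ) (h1 : γ ≤ 1 / 2) {x : ℕ → ℕ →₀ ℝ}
    (hx : SuccessiveBlocks x) (s : Finset ℕ) :
    tirilmanNorm p γ (∑ j ∈ s, x j) ≤ 4 * (∑ j ∈ s, tirilmanNorm p γ (x j) ^ p) ^ (1 / p) :=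
  ciSup_le fun m => tirilmanNormAux_sum_le hp h0 h1 m x hx s

/-- The averages of a vector with small coefficients with respect to a block sequence. -/
theorem sum_restr_flat_le (hp : 1 < p) (h0 : 0 < γ) (h1 : γ ≤ 1 / 2) {n : ℕ}
    {E : Fin n → Finset ℕ} (hE : IsSuccessive E) {x : ℕ → ℕ →₀ ℝ} (hx : SuccessiveBlocks x)
    (s : Finset ℕ) {η : ℝ} (hη : ∀ j ∈ s, tirilmanNorm p γ (x j) ≤ η) (hη0 : 0 ≤ η) :
    ∑ i, tirilmanNorm p γ (restr (E i) (∑ j ∈ s, x j)) ≤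
      4 * ((n : ℝ) ^ (1 / p.conjExponent) * (∑ j ∈ s, tirilmanNorm p γ (x j) ^ p) ^ (1 / p)) +
        2 * n * η := by
  have h1' : γ < 1 := by linarith
  refine (sum_restr_sum_le (Nf := tirilmanNorm p γ) tirilmanNorm_zero
    (tirilmanNorm_add_le hp h0 h1') E x s).trans (add_le_add ?_ ?_)
  · calc _ ≤ ∑ i, 4 * (∑ j ∈ s \ edgeBlocks E x s,
          tirilmanNorm p γ (restr (E i) (x j)) ^ p) ^ (1 / p) :=
          Finset.sum_le_sum fun i _ => tirilmanNorm_sum_le hp h0 h1 (hx.restr fun _ => E i) _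
      _ = 4 * ∑ i, (∑ j ∈ s \ edgeBlocks E x s,
          tirilmanNorm p γ (restr (E i) (x j)) ^ p) ^ (1 / p) := by
          rw [Finset.mul_sum]
      _ ≤ _ := mul_le_mul_of_nonneg_left (sum_interior_le hp h0 h1' E x s) (by norm_num)
  -- For cut blocks only the number of pieces is used, each of norm at most `η`. This is the gain
  -- from flatness when `n` is small compared with `1 / η`.
  · have hc := sum_card_meeting_le hE hx (s := edgeBlocks E x s)
      fun j hj => (Finset.mem_filter.1 hj).2
    calc _ ≤ ∑ j ∈ edgeBlocks E x s, ∑ i ∈ meeting E (x j), η :=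
          Finset.sum_le_sum fun j hj => Finset.sum_le_sum fun i _ =>
            (tirilmanNorm_restr_le hp h0 h1' _ _).trans (hη j (Finset.mem_filter.1 hj).1)
      _ = (∑ j ∈ edgeBlocks E x s, ((meeting E (x j)).card : ℝ)) * η := by
          simp only [Finset.sum_const, nsmul_eq_mul, Finset.sum_mul]
      _ ≤ _ := mul_le_mul_of_nonneg_right (by exact_mod_cast hc) hη0


/-! ### Coefficients with respect to a block sequence -/

/-- The `p`-th power of the `ℓ_p` norm of a finitely supported sequence. -/
def lpSum (p : ℝ) (a : ℕ →₀ ℝ) : ℝ :=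
  a.sum fun _ t => |t| ^ p

theorem lpSum_nonneg (a : ℕ →₀ ℝ) : 0 ≤ lpSum p a :=
  Finset.sum_nonneg fun _ _ => Real.rpow_nonneg (abs_nonneg _) _

theorem lpSum_eq_sum (hp : 0 < p) {a : ℕ →₀ ℝ} {s : Finset ℕ} (h : a.support ⊆ s) :
    lpSum p a = ∑ k ∈ s, |a k| ^ p :=
  Finset.sum_subset h fun k _ hk => by
    change |a k| ^ p = 0
    rw [Finsupp.notMem_support_iff.1 hk, abs_zero, Real.zero_rpow hp.ne']

theorem lpSum_smul (hp : 0 < p) (c : ℝ) (a : ℕ →₀ ℝ) : lpSum p (c • a) = |c| ^ p * lpSum p a := by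
  rw [lpSum_eq_sum hp (Finsupp.support_smul), lpSum, Finsupp.sum, Finset.mul_sum]
  refine Finset.sum_congr rfl fun k _ => ?_
  rw [Finsupp.smul_apply, smul_eq_mul, abs_mul, Real.mul_rpow (abs_nonneg _) (abs_nonneg _)]

theorem lpSum_add (hp : 0 < p) {a b : ℕ →₀ ℝ} (h : ∀ k, a k = 0 ∨ b k = 0) :
    lpSum p (a + b) = lpSum p a + lpSum p b := by
  classical
  rw [lpSum_eq_sum hp (Finsupp.support_add),
    lpSum_eq_sum hp (Finset.subset_union_left (s₁ := a.support) (s₂ := b.support)),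
    lpSum_eq_sum hp (Finset.subset_union_right (s₁ := a.support) (s₂ := b.support)),
    ← Finset.sum_add_distrib]
  refine Finset.sum_congr rfl fun k _ => ?_
  rcases h k with h | h <;> simp [h, Real.zero_rpow hp.ne']

theorem abs_le_one_of_lpSum (hp : 0 < p) {a : ℕ →₀ ℝ} (h : lpSum p a = 1) (k : ℕ) :
    |a k| ≤ 1 := by
  by_cases hk : k ∈ a.support
  · have h1 : |a k| ^ p ≤ 1 := by
      rw [← h]
      exact Finset.single_le_sum (f := fun k => |a k| ^ p)
        (fun _ _ => Real.rpow_nonneg (abs_nonneg _) _) hk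
    by_contra! h2
    exact not_lt.2 h1 (Real.one_lt_rpow h2 hp)
  · rw [Finsupp.notMem_support_iff.1 hk, abs_zero]
    exact zero_le_one

theorem SuccessiveBlocks.exists_forall_ne {x : ℕ → ℕ →₀ ℝ} (hx : SuccessiveBlocks x) (k : ℕ) :
    ∃ i₀, ∀ i, i ≠ i₀ → x i k = 0 := by
  by_cases h : ∃ i, x i k ≠ 0
  · obtain ⟨i₀, hi₀⟩ := h
    refine ⟨i₀, fun i hi => ?_⟩
    by_contra hik
    rcases lt_or_gt_of_ne hi with h | h
    · exact lt_irrefl _ (hx _ _ h k hik k hi₀)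
    · exact lt_irrefl _ (hx _ _ h k hi₀ k hik)
  · push Not at h
    exact ⟨0, fun i _ => h i⟩

theorem linearCombination_apply_of_forall_ne {x : ℕ → ℕ →₀ ℝ} {k i₀ : ℕ}
    (h : ∀ i, i ≠ i₀ → x i k = 0) (d : ℕ →₀ ℝ) :
    Finsupp.linearCombination ℝ x d k = d i₀ * x i₀ k := by
  rw [Finsupp.linearCombination_apply, Finsupp.sum, Finsupp.finsetSum_apply]
  by_cases hi : i₀ ∈ d.support
  · rw [Finset.sum_eq_single i₀ (fun i _ hi => by simp [h i hi]) fun h' => absurd hi h']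
    simp
  · rw [Finsupp.notMem_support_iff.1 hi, zero_mul]
    refine Finset.sum_eq_zero fun i hi' => ?_
    have : i ≠ i₀ := by rintro rfl; exact hi hi'
    simp [h i this]

theorem lpSum_linearCombination (hp : 0 < p) {x : ℕ → ℕ →₀ ℝ} (hx : SuccessiveBlocks x)
    (h1 : ∀ i, lpSum p (x i) = 1) (d : ℕ →₀ ℝ) :
    lpSum p (Finsupp.linearCombination ℝ x d) = lpSum p d := by
  induction d using Finsupp.induction with
  | zero => simp
  | single_add i t f hi _ ih =>
    rw [map_add, Finsupp.linearCombination_single, lpSum_add hp, lpSum_add hp, ih,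
      lpSum_smul hp, h1, mul_one]
    · congr 1
      rw [lpSum, Finsupp.sum_single_index (by rw [abs_zero, Real.zero_rpow hp.ne'])]
    · intro k
      by_cases hk : k = i
      · subst hk; exact Or.inr (Finsupp.notMem_support_iff.1 hi)
      · exact Or.inl (Finsupp.single_eq_of_ne hk)
    · intro k
      obtain ⟨i₀, hi₀⟩ := hx.exists_forall_ne k
      by_cases h : i = i₀
      · subst h
        right
        rw [linearCombination_apply_of_forall_ne hi₀, Finsupp.notMem_support_iff.1 hi, zero_mul]
      · left
        simp [hi₀ i h]

theorem exists_of_linearCombination_ne_zero {u : ℕ → ℕ →₀ ℝ} {a : ℕ →₀ ℝ} {i : ℕ}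
    (h : Finsupp.linearCombination ℝ u a i ≠ 0) : ∃ k, a k ≠ 0 ∧ u k i ≠ 0 := by
  by_contra! h'
  refine h ?_
  rw [Finsupp.linearCombination_apply, Finsupp.sum, Finsupp.finsetSum_apply]
  refine Finset.sum_eq_zero fun k hk => ?_
  simp [h' k (Finsupp.mem_support_iff.1 hk)]

theorem SuccessiveBlocks.linearCombination {u a : ℕ → ℕ →₀ ℝ} (hu : SuccessiveBlocks u)
    (ha : SuccessiveBlocks a) : SuccessiveBlocks fun i => Finsupp.linearCombination ℝ u (a i) := by
  intro i j hij x hx y hy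
  obtain ⟨k, hk, hkx⟩ := exists_of_linearCombination_ne_zero hx
  obtain ⟨l, hl, hly⟩ := exists_of_linearCombination_ne_zero hy
  exact hu k l (ha i j hij k hk l hl) x hkx y hly

theorem SuccessiveBlocks.smul {x : ℕ → ℕ →₀ ℝ} (hx : SuccessiveBlocks x) (c : ℕ → ℝ) :
    SuccessiveBlocks fun i => c i • x i := by
  intro i j hij k hk l hl
  exact hx i j hij k (fun h => hk (by simp [h])) l (fun h => hl (by simp [h]))

theorem sum_rpow_smul_le (hp : 0 < p) {u : ℕ → ℕ →₀ ℝ} {D : ℝ}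
    (hD : ∀ k, tirilmanNorm p γ (u k) ≤ D) (a : ℕ →₀ ℝ) :
    (∑ k ∈ a.support, tirilmanNorm p γ (a k • u k) ^ p) ^ (1 / p) ≤ D * lpSum p a ^ (1 / p) := by
  have hD0 : 0 ≤ D := (tirilmanNorm_nonneg _).trans (hD 0)
  have : ∑ k ∈ a.support, tirilmanNorm p γ (a k • u k) ^ p ≤ D ^ p * lpSum p a := by
    rw [lpSum, Finsupp.sum, Finset.mul_sum]
    refine Finset.sum_le_sum fun k _ => ?_
    rw [tirilmanNorm_smul, Real.mul_rpow (abs_nonneg _) (tirilmanNorm_nonneg _), mul_comm]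
    exact mul_le_mul_of_nonneg_right (Real.rpow_le_rpow (tirilmanNorm_nonneg _) (hD k) hp.le)
      (Real.rpow_nonneg (abs_nonneg _) _)
  refine (Real.rpow_le_rpow (Finset.sum_nonneg fun k _ =>
    Real.rpow_nonneg (tirilmanNorm_nonneg _) _) this (by positivity)).trans_eq ?_
  rw [Real.mul_rpow (by positivity) (lpSum_nonneg a), ← Real.rpow_mul hD0,
    mul_one_div_cancel hp.ne', Real.rpow_one]

theorem tirilmanNorm_linearCombination_le (hp : 1 < p) (h0 : 0 < γ) (h1 : γ ≤ 1 / 2)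
    {u : ℕ → ℕ →₀ ℝ} (hu : SuccessiveBlocks u) {D : ℝ} (hD : ∀ k, tirilmanNorm p γ (u k) ≤ D)
    (a : ℕ →₀ ℝ) :
    tirilmanNorm p γ (Finsupp.linearCombination ℝ u a) ≤ 4 * (D * lpSum p a ^ (1 / p)) := by
  rw [Finsupp.linearCombination_apply, Finsupp.sum]
  exact (tirilmanNorm_sum_le hp h0 h1 (hu.smul a) a.support).trans
    (mul_le_mul_of_nonneg_left (sum_rpow_smul_le (by linarith) hD a) (by norm_num))

/-! ### Stabilization of the lower `p`-estimate -/

/-- The normalized elements of `ℓ_p` supported in `[m, ∞)` with coefficients at most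
`1 / (m + 1)`. -/
def flatTail (p : ℝ) (m : ℕ) : Set (ℕ →₀ ℝ) :=
  {a | lpSum p a = 1 ∧ (∀ k, a k ≠ 0 → m ≤ k) ∧ ∀ k, |a k| ≤ 1 / ((m : ℝ) + 1)}

theorem flatTail_anti : Antitone (flatTail p) := by
  rintro m n hmn a ⟨h1, h2, h3⟩
  refine ⟨h1, fun k hk => hmn.trans (h2 k hk), fun k => (h3 k).trans ?_⟩
  exact one_div_le_one_div_of_le (by positivity) (by exact_mod_cast Nat.succ_le_succ hmn)

theorem flatTail_nonempty (hp : 0 < p) (m : ℕ) : (flatTail p m).Nonempty := by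
  -- The witness is constant on an interval of length `L > (m + 1) ^ p`, with value `L ^ (-1/p)`.
  classical
  obtain ⟨L, hL⟩ := exists_nat_gt (((m : ℝ) + 1) ^ p)
  have hm : (0 : ℝ) < ((m : ℝ) + 1) ^ p := by positivity
  have hL0 : (0 : ℝ) < L := hm.trans hL
  set c : ℝ := (L : ℝ)⁻¹ ^ (1 / p) with hc
  have hc0 : 0 ≤ c := by positivity
  let a : ℕ →₀ ℝ := Finsupp.onFinset (Finset.Ico m (m + L))
    (fun k => if k ∈ Finset.Ico m (m + L) then c else 0) fun k hk => by
      by_contra h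
      exact hk (if_neg h)
  have ha : ∀ k, a k = if k ∈ Finset.Ico m (m + L) then c else 0 := fun k => rfl
  refine ⟨a, ?_, fun k hk => ?_, fun k => ?_⟩
  · rw [lpSum_eq_sum hp (s := Finset.Ico m (m + L)) Finsupp.support_onFinset_subset]
    have : ∀ k ∈ Finset.Ico m (m + L), |a k| ^ p = (L : ℝ)⁻¹ := by
      intro k hk
      rw [ha, if_pos hk, abs_of_nonneg hc0, hc, ← Real.rpow_mul (by positivity),
        one_div_mul_cancel hp.ne', Real.rpow_one]
    rw [Finset.sum_congr rfl this, Finset.sum_const, Nat.card_Ico, nsmul_eq_mul,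
      Nat.add_sub_cancel_left]
    exact mul_inv_cancel₀ hL0.ne'
  · by_contra h
    refine hk ?_
    rw [ha, if_neg]
    simp only [Finset.mem_Ico]
    omega
  · rw [ha]
    split_ifs
    · rw [abs_of_nonneg hc0, one_div ((m : ℝ) + 1)]
      have h1 : (((m : ℝ) + 1) ^ p)⁻¹ ^ (1 / p) = ((m : ℝ) + 1)⁻¹ := by
        rw [Real.inv_rpow hm.le, ← Real.rpow_mul (by positivity), mul_one_div_cancel hp.ne',
          Real.rpow_one]
      rw [hc, ← h1]
      exact Real.rpow_le_rpow (by positivity) (inv_anti₀ hm hL.le) (by positivity)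
    · rw [abs_zero]
      positivity

/-- `K` is the supremum over `m` of the infima of the norm on `flatTail p m`; it is finite by the
upper `p`-estimate and at least `c`. Far enough out the infimum is almost `K`, yet at every stage
some vector has norm at most slightly above `K`. -/
theorem exists_stable_lower_constant (hp : 1 < p) (h0 : 0 < γ) (h1 : γ ≤ 1 / 2)
    {u : ℕ → ℕ →₀ ℝ} (hu : SuccessiveBlocks u) {D c : ℝ}
    (hD : ∀ k, tirilmanNorm p γ (u k) ≤ D) (hc : 0 < c)
    (hl : ∀ a, lpSum p a = 1 → c ≤ tirilmanNorm p γ (Finsupp.linearCombination ℝ u a))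
    {ε : ℝ} (hε : 0 < ε) :
    ∃ K m, c ≤ K ∧
      (∀ a ∈ flatTail p m, (1 - ε) * K ≤ tirilmanNorm p γ (Finsupp.linearCombination ℝ u a)) ∧
      ∀ n, ∃ a ∈ flatTail p n, tirilmanNorm p γ (Finsupp.linearCombination ℝ u a) ≤ (1 + ε) * K := by
  have hp0 : 0 < p := by linarith
  let V : ℕ → Set ℝ := fun m =>
    (fun a => tirilmanNorm p γ (Finsupp.linearCombination ℝ u a)) '' flatTail p m
  have hne : ∀ m, (V m).Nonempty := fun m => (flatTail_nonempty hp0 m).image _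
  have hbb : ∀ m, BddBelow (V m) := fun m => ⟨0, by
    rintro _ ⟨a, -, rfl⟩
    exact tirilmanNorm_nonneg _⟩
  have hbdd : BddAbove (Set.range fun m => sInf (V m)) := by
    refine ⟨4 * D, ?_⟩
    rintro _ ⟨m, rfl⟩
    obtain ⟨a, ha⟩ := flatTail_nonempty hp0 m
    refine (csInf_le (hbb m) ⟨a, ha, rfl⟩).trans
      ((tirilmanNorm_linearCombination_le hp h0 h1 hu hD a).trans_eq ?_)
    rw [ha.1, Real.one_rpow, mul_one]
  have hcK : c ≤ ⨆ m, sInf (V m) := by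
    refine le_trans (le_csInf (hne 0) ?_) (le_ciSup hbdd 0)
    rintro _ ⟨a, ha, rfl⟩
    exact hl a ha.1
  set K := ⨆ m, sInf (V m) with hK
  have hK0 : 0 < K := hc.trans_le hcK
  obtain ⟨m, hm⟩ := exists_lt_of_lt_ciSup (show (1 - ε) * K < ⨆ m, sInf (V m) by
    rw [← hK]; nlinarith)
  refine ⟨K, m, hcK, fun a ha => hm.le.trans (csInf_le (hbb m) ⟨a, ha, rfl⟩), fun n => ?_⟩
  have hn : sInf (V n) < (1 + ε) * K := (le_ciSup hbdd n).trans_lt (by rw [← hK]; nlinarith)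
  obtain ⟨_, ⟨a, ha, rfl⟩, hlt⟩ := exists_lt_of_csInf_lt (hne n) hn
  exact ⟨a, ha, hlt.le⟩

/-- James' argument: a block sequence with a lower `p`-estimate has a block sequence of vectors of
norm at most one with a lower `p`-estimate with constant `1 / 2`. -/
theorem exists_blocks_half (hp : 1 < p) (h0 : 0 < γ) (h1 : γ ≤ 1 / 2)
    {u : ℕ → ℕ →₀ ℝ} (hu : SuccessiveBlocks u) {D c : ℝ}
    (hD : ∀ k, tirilmanNorm p γ (u k) ≤ D) (hc : 0 < c)
    (hl : ∀ a, lpSum p a = 1 → c ≤ tirilmanNorm p γ (Finsupp.linearCombination ℝ u a)) :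
    ∃ v : ℕ → ℕ →₀ ℝ, SuccessiveBlocks v ∧ (∀ k, tirilmanNorm p γ (v k) ≤ 1) ∧
      ∀ d, lpSum p d = 1 → 1 / 2 ≤ tirilmanNorm p γ (Finsupp.linearCombination ℝ v d) := by
  have hp0 : 0 < p := by linarith
  obtain ⟨K, m, hcK, hlow, hup⟩ := exists_stable_lower_constant hp h0 h1 hu hD hc hl
    (ε := 1 / 3) (by norm_num)
  have hK0 : 0 < K := hc.trans_le hcK
  choose g hg hgK using hup
  -- Each nearly minimal vector starts beyond the support of its predecessor. Normalized `ℓ_p`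
  -- combinations of such vectors stay in `flatTail p m`, so the lower bound still applies. With `ε
  -- = 1/3`, the ratio of the lower and upper bounds is `(2/3) / (4/3) = 1/2`.
  let M : ℕ → ℕ := fun n => Nat.rec m (fun _ r => r + (g r).support.sup id + 1) n
  have hM : ∀ n, M (n + 1) = M n + (g (M n)).support.sup id + 1 := fun n => rfl
  have hMm : Monotone M := monotone_nat_of_le_succ fun n => by rw [hM]; omega
  let a : ℕ → ℕ →₀ ℝ := fun i => g (M i)
  have ha : SuccessiveBlocks a := by
    intro i j hij k hk l hl
    have h2 : k ≤ (g (M i)).support.sup id :=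
      Finset.le_sup (f := id) (Finsupp.mem_support_iff.2 hk)
    have h3 : M j ≤ l := (hg (M j)).2.1 l hl
    have h4 : M (i + 1) ≤ M j := hMm hij
    rw [hM] at h4
    omega
  set r : ℝ := (4 / 3 * K)⁻¹ with hr
  have hr0 : 0 < r := by positivity
  refine ⟨fun i => r • Finsupp.linearCombination ℝ u (a i), (hu.linearCombination ha).smul _,
    fun k => ?_, fun d hd => ?_⟩
  · rw [tirilmanNorm_smul, abs_of_pos hr0]
    calc _ ≤ r * ((1 + 1 / 3) * K) := mul_le_mul_of_nonneg_left (hgK _) hr0.le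
      _ = 1 := by rw [hr]; field_simp; norm_num
  · have heq : Finsupp.linearCombination ℝ (fun i => r • Finsupp.linearCombination ℝ u (a i)) d =
        r • Finsupp.linearCombination ℝ u (Finsupp.linearCombination ℝ a d) := by
      simp only [Finsupp.linearCombination_apply ℝ d, Finsupp.sum, map_sum, map_smul,
        Finset.smul_sum]
      exact Finset.sum_congr rfl fun i _ => smul_comm _ _ _
    have hmem : Finsupp.linearCombination ℝ a d ∈ flatTail p m := by
      refine ⟨(lpSum_linearCombination hp0 ha (fun i => (hg _).1) d).trans hd, fun k hk => ?_,
        fun k => ?_⟩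
      · obtain ⟨i, -, hi⟩ := exists_of_linearCombination_ne_zero hk
        exact (hMm (Nat.zero_le i)).trans ((hg (M i)).2.1 k hi)
      · obtain ⟨i, hi⟩ := ha.exists_forall_ne k
        rw [linearCombination_apply_of_forall_ne hi, abs_mul]
        have h2 : a i ∈ flatTail p m := flatTail_anti (hMm (Nat.zero_le i)) (hg (M i))
        calc _ ≤ 1 * |a i k| :=
              mul_le_mul_of_nonneg_right (abs_le_one_of_lpSum hp0 hd i) (abs_nonneg _)
          _ ≤ _ := by rw [one_mul]; exact h2.2.2 k
    rw [heq, tirilmanNorm_smul, abs_of_pos hr0]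
    calc (1 : ℝ) / 2 = r * ((1 - 1 / 3) * K) := by rw [hr]; field_simp; norm_num
      _ ≤ _ := mul_le_mul_of_nonneg_left (hlow _ hmem) hr0.le

/-! ### Adding a flat vector, and the failure of lower `p`-estimates -/

theorem sum_tirilmanNorm_restr_le (hp : 1 < p) (h0 : 0 < γ) (h1 : γ < 1) {n : ℕ}
    {E : Fin n → Finset ℕ} (hE : IsSuccessive E) (a : ℕ →₀ ℝ) :
    ∑ i, tirilmanNorm p γ (restr (E i) a) ≤ ∑ k ∈ a.support, |a k| := by
  refine le_trans (Finset.sum_le_sum fun i _ => ?_) (sum_sum_abs_filter_le hE a)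
  rw [← filter_eq_restr]
  exact tirilmanNorm_le_sum hp h0 h1 _

/-- The sum of two vectors, the second one flat in comparison with the first one. -/
theorem tirilmanNorm_add_flat_le (hp : 1 < p) (h0 : 0 < γ) (h1 : γ ≤ 1 / 2)
    {v : ℕ → ℕ →₀ ℝ} (hv : SuccessiveBlocks v) (hv1 : ∀ k, tirilmanNorm p γ (v k) ≤ 1)
    {A δ : ℝ} (hδ : 0 < δ) {y : ℕ →₀ ℝ} (hy : tirilmanNorm p γ y ≤ A) :
    ∃ m₀, ∀ m ≥ m₀, ∀ a ∈ flatTail p m,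
      tirilmanNorm p γ (Finsupp.linearCombination ℝ v a) ≤ A →
      (∀ k, y k = 0 ∨ Finsupp.linearCombination ℝ v a k = 0) →
      tirilmanNorm p γ (y + Finsupp.linearCombination ℝ v a) ≤ A + 4 * γ + δ := by
  have h1' : γ < 1 := by linarith
  have hp0 : 0 < p := by linarith
  have hq0 : 0 < 1 / p.conjExponent :=
    one_div_pos.2 (Real.HolderConjugate.conjExponent hp).symm.pos
  set l := ∑ k ∈ y.support, |y k| with hl
  have ht : Tendsto (fun n : ℕ => (n : ℝ) ^ (1 / p.conjExponent) * δ) atTop atTop :=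
    ((tendsto_rpow_atTop hq0).comp tendsto_natCast_atTop_atTop).atTop_mul_const hδ
  -- `n₀` separates two regimes. For at least `n₀` sets the `ℓ_1` norm of `y` is negligible after
  -- averaging. For fewer sets, `m₀ ≥ 2 * n₀ / δ` makes the cut pieces of the flat vector
  -- negligible, and its other pieces cost at most `4 * γ`.
  obtain ⟨n₀, hn₀⟩ := eventually_atTop.1 (ht.eventually_ge_atTop l)
  obtain ⟨m₀, hm₀⟩ := exists_nat_ge (2 * n₀ / δ)
  refine ⟨m₀, fun m hm a ha hzA hdisj => ?_⟩
  set z := Finsupp.linearCombination ℝ v a with hz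
  refine tirilmanNorm_le hp h0 h1' (fun i => ?_) fun n E hn hE => ?_
  · have : |(y + z) i| ≤ A := by
      rw [Finsupp.add_apply]
      rcases hdisj i with h | h
      · rw [h, zero_add]
        exact (abs_apply_le_tirilmanNorm hp h0 h1' z i).trans hzA
      · rw [h, add_zero]
        exact (abs_apply_le_tirilmanNorm hp h0 h1' y i).trans hy
    linarith
  have hone : 1 ≤ (n : ℝ) ^ (1 / p.conjExponent) := one_le_rpow_conj hp hn
  set w := (n : ℝ) ^ (1 / p.conjExponent) with hw
  have hsum : γ * ∑ i, tirilmanNorm p γ (restr (E i) (y + z)) ≤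
      γ * ∑ i, tirilmanNorm p γ (restr (E i) y) + γ * ∑ i, tirilmanNorm p γ (restr (E i) z) := by
    rw [← mul_add, ← Finset.sum_add_distrib]
    refine mul_le_mul_of_nonneg_left (Finset.sum_le_sum fun i _ => ?_) h0.le
    rw [map_add]
    exact tirilmanNorm_add_le hp h0 h1' _ _
  have hI : ∀ b : ℕ →₀ ℝ, tirilmanNorm p γ b ≤ A →
      γ * ∑ i, tirilmanNorm p γ (restr (E i) b) ≤ w * A := fun b hb =>
    ((sum_restr_le hp h0 h1' b Finset.univ hE.successiveSets).trans_eq (by simp [hw])).trans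
      (mul_le_mul_of_nonneg_left hb (by linarith))
  refine hsum.trans ?_
  rcases le_or_gt n₀ n with hcase | hcase
  · have h2 := sum_tirilmanNorm_restr_le hp h0 h1' hE y
    have h3 : l ≤ w * δ := hn₀ n hcase
    have h4 : γ * ∑ i, tirilmanNorm p γ (restr (E i) y) ≤ w * δ := by
      have : 0 ≤ ∑ i, tirilmanNorm p γ (restr (E i) y) :=
        Finset.sum_nonneg fun i _ => tirilmanNorm_nonneg _
      nlinarith
    nlinarith [hI z hzA]
  · have hm' : (0 : ℝ) < (m : ℝ) + 1 := by positivity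
    have h2 := sum_restr_flat_le hp h0 h1 hE (hv.smul a) a.support (η := 1 / ((m : ℝ) + 1))
      (fun j _ => by
        rw [tirilmanNorm_smul]
        exact (mul_le_of_le_one_right (abs_nonneg _) (hv1 j)).trans (ha.2.2 j)) (by positivity)
    have h3 := sum_rpow_smul_le hp0 hv1 a
    rw [ha.1, Real.one_rpow, one_mul] at h3
    have h4 : 2 * (n : ℝ) * (1 / ((m : ℝ) + 1)) ≤ δ := by
      rw [mul_one_div, div_le_iff₀ hm']
      rw [div_le_iff₀ hδ] at hm₀
      have h5 : (n : ℝ) ≤ n₀ := by exact_mod_cast hcase.le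
      have h6 : (m₀ : ℝ) ≤ m := by exact_mod_cast hm
      nlinarith
    have h5 : ∑ i, tirilmanNorm p γ (restr (E i) z) ≤ 4 * w + δ := by
      rw [hz, Finsupp.linearCombination_apply, Finsupp.sum]
      refine h2.trans (add_le_add ?_ h4)
      have : w * (∑ k ∈ a.support, tirilmanNorm p γ (a k • v k) ^ p) ^ (1 / p) ≤ w * 1 :=
        mul_le_mul_of_nonneg_left h3 (by linarith)
      linarith
    have h6 : γ * ∑ i, tirilmanNorm p γ (restr (E i) z) ≤ γ * (4 * w + δ) :=
      mul_le_mul_of_nonneg_left h5 h0.le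
    nlinarith [hI y hy]

/-- `Ti(p, γ)` contains no block sequence with a lower `p`-estimate, if `γ` is small. -/
theorem not_lower_estimate (hp : 1 < p) (h0 : 0 < γ)
    (hγ : γ < ((2 : ℝ) ^ (1 / p) - 1) / 16) {u : ℕ → ℕ →₀ ℝ} (hu : SuccessiveBlocks u) {D c : ℝ}
    (hD : ∀ k, tirilmanNorm p γ (u k) ≤ D) (hc : 0 < c)
    (hl : ∀ a, lpSum p a = 1 → c ≤ tirilmanNorm p γ (Finsupp.linearCombination ℝ u a)) :
    False := by
  have hp0 : 0 < p := by linarith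
  set t : ℝ := (2 : ℝ) ^ (1 / p) with ht
  have ht1 : 1 < t := Real.one_lt_rpow (by norm_num) (by positivity)
  have ht2 : t ≤ 2 := by
    conv_rhs => rw [← Real.rpow_one 2]
    exact Real.rpow_le_rpow_of_exponent_le (by norm_num) (by rw [div_le_one hp0]; exact hp.le)
  have h1 : γ ≤ 1 / 2 := by linarith
  -- This makes the smallness of `γ` independent of `c`: the new stable constant `K` is at least
  -- `1/2`, so the error `4 * γ` below is at most `8 * γ * K`.
  obtain ⟨v, hv, hv1, hvl⟩ := exists_blocks_half hp h0 h1 hu hD hc hl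
  set ε := (t - 1) / 16 with hε
  have hε0 : 0 < ε := by rw [hε]; linarith
  obtain ⟨K, m, hK, hlow, hup⟩ := exists_stable_lower_constant hp h0 h1 hv hv1
    (by norm_num : (0 : ℝ) < 1 / 2) hvl hε0
  obtain ⟨a, ha, haK⟩ := hup m
  have hK0 : 0 < K := by linarith
  obtain ⟨m₀, hm₀⟩ := tirilmanNorm_add_flat_le hp h0 h1 hv hv1 (A := (1 + ε) * K)
    (δ := ε * K) (by positivity) haK
  set n := m₀ + m + a.support.sup id + 1 with hn
  obtain ⟨b, hb, hbK⟩ := hup n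
  have hab : ∀ k l, a k ≠ 0 → b l ≠ 0 → k < l := by
    intro k l hk hl
    have h2 : k ≤ a.support.sup id := Finset.le_sup (f := id) (Finsupp.mem_support_iff.2 hk)
    have h3 := hb.2.1 l hl
    omega
  have hdisj : ∀ k, a k = 0 ∨ b k = 0 := by
    intro k
    by_contra! h
    exact lt_irrefl k (hab k k h.1 h.2)
  have hupper := hm₀ n (by omega) b hb hbK fun k => by
    by_contra! h
    obtain ⟨i, hi, hik⟩ := exists_of_linearCombination_ne_zero h.1
    obtain ⟨j, hj, hjk⟩ := exists_of_linearCombination_ne_zero h.2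
    exact lt_irrefl k (hv i j (hab i j hi hj) k hik k hjk)
  have hmem : t⁻¹ • (a + b) ∈ flatTail p m := by
    have hb' : b ∈ flatTail p m := flatTail_anti (by omega) hb
    refine ⟨?_, fun k hk => ?_, fun k => ?_⟩
    · rw [lpSum_smul hp0, lpSum_add hp0 hdisj, ha.1, hb.1, abs_of_pos (by positivity),
        Real.inv_rpow (by positivity), ht, ← Real.rpow_mul (by norm_num),
        one_div_mul_cancel hp0.ne', Real.rpow_one]
      norm_num
    · rcases hdisj k with h | h
      · refine hb'.2.1 k fun h' => hk ?_
        simp [h, h']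
      · refine ha.2.1 k fun h' => hk ?_
        simp [h, h']
    · rw [Finsupp.smul_apply, smul_eq_mul, abs_mul, abs_of_pos (by positivity), Finsupp.add_apply]
      have : |a k + b k| ≤ 1 / ((m : ℝ) + 1) := by
        rcases hdisj k with h | h
        · rw [h, zero_add]; exact hb'.2.2 k
        · rw [h, add_zero]; exact ha.2.2 k
      exact (mul_le_of_le_one_left (abs_nonneg _) (inv_le_one_of_one_le₀ ht1.le)).trans this
  have hlower := hlow _ hmem
  rw [map_smul, tirilmanNorm_smul, abs_of_pos (by positivity), map_add,
    le_inv_mul_iff₀ (by linarith)] at hlower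
  have h3 := hlower.trans hupper
  have h4 : 4 * γ ≤ 8 * γ * K := by nlinarith
  have h5 : t * ((1 - ε) * K) ≤ (1 + 2 * ε + 8 * γ) * K := by linarith
  rw [← mul_assoc] at h5
  -- Now `t - 1 ≤ (t + 2) * ε + 8 * γ`. Since `t ≤ 2`, the first term is at most `(t - 1) / 4`, and
  -- the second is less than `(t - 1) / 2`.
  have h6 := le_of_mul_le_mul_right h5 hK0
  nlinarith


namespace Tirilman

variable {hp : 1 < p} {h0 : 0 < γ} {h1 : γ < 1}

/-! ### The completion -/

/-- The inclusion of the finitely supported sequences into the Tirilman space. -/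
def of : (ℕ →₀ ℝ) →ₗ[ℝ] Tirilman p γ hp h0 h1 :=
  (UniformSpace.Completion.toComplₗᵢ (𝕜 := ℝ) (E := TirilmanFin p γ hp h0 h1)).toLinearMap

theorem norm_of (a : ℕ →₀ ℝ) : ‖(of a : Tirilman p γ hp h0 h1)‖ = tirilmanNorm p γ a :=
  (UniformSpace.Completion.toComplₗᵢ (𝕜 := ℝ) (E := TirilmanFin p γ hp h0 h1)).norm_map _

theorem of_single (j : ℕ) :
    (of (Finsupp.single j 1) : Tirilman p γ hp h0 h1) = tirilmanBasis p γ hp h0 h1 j :=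
  rfl

@[elab_as_elim]
theorem induction_on {P : Tirilman p γ hp h0 h1 → Prop} (x : Tirilman p γ hp h0 h1)
    (hc : IsClosed {x | P x}) (h : ∀ a, P (of a)) : P x :=
  UniformSpace.Completion.induction_on x hc h

theorem exists_norm_sub_of_lt (x : Tirilman p γ hp h0 h1) {ε : ℝ} (hε : 0 < ε) :
    ∃ a, ‖x - of a‖ < ε := by
  have hd : DenseRange (of : (ℕ →₀ ℝ) → Tirilman p γ hp h0 h1) :=
    UniformSpace.Completion.denseRange_coe (α := TirilmanFin p γ hp h0 h1)
  obtain ⟨a, ha⟩ := Metric.denseRange_iff.1 hd x ε hε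
  exact ⟨a, by rwa [← dist_eq_norm]⟩

/-- The projection onto the coordinates in `S`. -/
def proj (S : Set ℕ) : Tirilman p γ hp h0 h1 →L[ℝ] Tirilman p γ hp h0 h1 :=
  ContinuousLinearMap.completion
    (LinearMap.mkContinuous (E := TirilmanFin p γ hp h0 h1) (F := TirilmanFin p γ hp h0 h1)
      (restr S) 1 fun a => (tirilmanNorm_restr_le hp h0 h1 S a).trans_eq (one_mul _).symm)

theorem proj_of (S : Set ℕ) (a : ℕ →₀ ℝ) :
    proj S (of a : Tirilman p γ hp h0 h1) = of (restr S a) :=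
  ContinuousLinearMap.completion_apply_coe _ _

theorem norm_proj_le (S : Set ℕ) (x : Tirilman p γ hp h0 h1) : ‖proj S x‖ ≤ ‖x‖ := by
  induction x using induction_on with
  | hc => exact isClosed_le (by fun_prop) (by fun_prop)
  | h a => rw [proj_of, norm_of, norm_of]; exact tirilmanNorm_restr_le hp h0 h1 S a

theorem proj_proj (S T : Set ℕ) (x : Tirilman p γ hp h0 h1) :
    proj S (proj T x) = proj (S ∩ T) x := by
  induction x using induction_on with
  | hc => exact isClosed_eq (by fun_prop) (by fun_prop)
  | h a => rw [proj_of, proj_of, proj_of, restr_restr]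

theorem norm_proj_mono {S T : Set ℕ} (h : S ⊆ T) (x : Tirilman p γ hp h0 h1) :
    ‖proj S x‖ ≤ ‖proj T x‖ := by
  rw [← Set.inter_eq_self_of_subset_left h, ← proj_proj]
  exact norm_proj_le _ _

theorem proj_add_proj {S T : Set ℕ} (h : Disjoint S T) (x : Tirilman p γ hp h0 h1) :
    proj S x + proj T x = proj (S ∪ T) x := by
  induction x using induction_on with
  | hc => exact isClosed_eq (by fun_prop) (by fun_prop)
  | h a =>
    rw [proj_of, proj_of, proj_of, ← map_add]
    congr 1
    ext i
    rw [Finsupp.add_apply]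
    by_cases hS : i ∈ S
    · rw [restr_of_mem hS, restr_of_notMem (Set.disjoint_left.1 h hS),
        restr_of_mem (Or.inl hS : i ∈ S ∪ T), add_zero]
    · rw [restr_of_notMem hS, zero_add]
      by_cases hT : i ∈ T
      · rw [restr_of_mem hT, restr_of_mem (Or.inr hT : i ∈ S ∪ T)]
      · rw [restr_of_notMem hT, restr_of_notMem]
        rintro (h | h)
        exacts [hS h, hT h]

theorem proj_univ (x : Tirilman p γ hp h0 h1) : proj Set.univ x = x := by
  induction x using induction_on with
  | hc => exact isClosed_eq (by fun_prop) (by fun_prop)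
  | h a => rw [proj_of, restr_eq_self fun i _ => Set.mem_univ i]

theorem proj_empty (x : Tirilman p γ hp h0 h1) : proj ∅ x = 0 := by
  induction x using induction_on with
  | hc => exact isClosed_eq (by fun_prop) (by fun_prop)
  | h a =>
    rw [proj_of, ← map_zero of]
    congr 1
    ext i
    exact restr_of_notMem (Set.notMem_empty i) a

theorem sum_norm_proj_le (x : Tirilman p γ hp h0 h1) {ι : Type*} [LinearOrder ι] (s : Finset ι)
    {S : ι → Set ℕ} (hS : SuccessiveSets S) :
    γ * ∑ i ∈ s, ‖proj (S i) x‖ ≤ (s.card : ℝ) ^ (1 / p.conjExponent) * ‖x‖ := by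
  induction x using induction_on with
  | hc => exact isClosed_le (by fun_prop) (by fun_prop)
  | h a => simp only [proj_of, norm_of]; exact sum_restr_le hp h0 h1 a s hS

theorem restr_Ici_eq_restr_Ico (a : ℕ →₀ ℝ) (n : ℕ) {m : ℕ} (hm : a.support.sup id < m) :
    restr (Set.Ici n) a = restr (Set.Ico n m) a := by
  ext i
  by_cases hn : i ∈ Set.Ici n
  · by_cases hi : i ∈ Set.Ico n m
    · rw [restr_of_mem hn, restr_of_mem hi]
    · rw [restr_of_mem hn, restr_of_notMem hi]
      by_contra h
      have : i ≤ a.support.sup id := Finset.le_sup (f := id) (Finsupp.mem_support_iff.2 h)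
      exact hi ⟨hn, this.trans_lt hm⟩
  · rw [restr_of_notMem hn, restr_of_notMem fun h : i ∈ Set.Ico n m => hn h.1]

theorem tendsto_norm_proj_Ici (x : Tirilman p γ hp h0 h1) :
    Tendsto (fun n => ‖proj (Set.Ici n) x‖) atTop (𝓝 0) := by
  rw [Metric.tendsto_atTop]
  intro ε hε
  obtain ⟨a, ha⟩ := exists_norm_sub_of_lt x hε
  refine ⟨a.support.sup id + 1, fun n hn => ?_⟩
  rw [Real.dist_0_eq_abs, abs_norm]
  have h : proj (Set.Ici n) (of a : Tirilman p γ hp h0 h1) = 0 := by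
    rw [proj_of, restr_Ici_eq_restr_Ico a n hn, Set.Ico_self, ← proj_of, proj_empty]
  calc ‖proj (Set.Ici n) x‖ = ‖proj (Set.Ici n) (x - of a)‖ := by rw [map_sub, h, sub_zero]
    _ ≤ ‖x - of a‖ := norm_proj_le _ _
    _ < ε := ha

/-! ### Functionals -/

theorem opNorm_comp_proj_le (f : Tirilman p γ hp h0 h1 →L[ℝ] ℝ) (S : Set ℕ) :
    ‖f.comp (proj S)‖ ≤ ‖f‖ :=
  ContinuousLinearMap.opNorm_le_bound _ (norm_nonneg _) fun x =>
    (f.le_opNorm _).trans (mul_le_mul_of_nonneg_left (norm_proj_le S x) (norm_nonneg _))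

theorem opNorm_comp_proj_mono (f : Tirilman p γ hp h0 h1 →L[ℝ] ℝ) {S T : Set ℕ} (h : S ⊆ T) :
    ‖f.comp (proj S)‖ ≤ ‖f.comp (proj T)‖ := by
  have : f.comp (proj S) = (f.comp (proj T)).comp (proj S) := by
    ext x
    simp only [ContinuousLinearMap.comp_apply, proj_proj, Set.inter_eq_self_of_subset_right h]
  rw [this]
  exact opNorm_comp_proj_le _ _

theorem opNorm_comp_proj_le_of_forall {f : Tirilman p γ hp h0 h1 →L[ℝ] ℝ} {S : Set ℕ} {t : ℝ}
    (ht : 0 ≤ t) (h : ∀ a, |f (of (restr S a))| ≤ t * tirilmanNorm p γ a) :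
    ‖f.comp (proj S)‖ ≤ t := by
  refine ContinuousLinearMap.opNorm_le_bound _ ht fun x => ?_
  induction x using induction_on with
  | hc => exact isClosed_le (by fun_prop) (by fun_prop)
  | h a =>
    rw [ContinuousLinearMap.comp_apply, proj_of, norm_of]
    exact h a

theorem opNorm_comp_proj_finset_le (f : Tirilman p γ hp h0 h1 →L[ℝ] ℝ) (s : Finset ℕ) :
    ‖f.comp (proj (s : Set ℕ))‖ ≤ ∑ i ∈ s, |f (tirilmanBasis p γ hp h0 h1 i)| := by
  refine opNorm_comp_proj_le_of_forall (Finset.sum_nonneg fun _ _ => abs_nonneg _) fun a => ?_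
  have : restr (s : Set ℕ) a = ∑ i ∈ s, a i • Finsupp.single i 1 := by
    ext k
    rw [Finsupp.finsetSum_apply]
    simp only [Finsupp.smul_single, smul_eq_mul, mul_one, Finsupp.single_apply,
      Finset.sum_ite_eq']
    split_ifs with hk
    · exact restr_of_mem (by exact_mod_cast hk) a
    · exact restr_of_notMem (by exact_mod_cast hk) a
  rw [this, map_sum, map_sum, Finset.sum_mul]
  refine (Finset.abs_sum_le_sum_abs _ _).trans (Finset.sum_le_sum fun i _ => ?_)
  rw [map_smul, map_smul, of_single, smul_eq_mul, abs_mul, mul_comm]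
  exact mul_le_mul_of_nonneg_left (abs_apply_le_tirilmanNorm hp h0 h1 a i) (abs_nonneg _)

/-- The dual form of the upper `p`-estimate. -/
theorem mul_card_rpow_le (hγ : γ ≤ 1 / 2) (f : Tirilman p γ hp h0 h1 →L[ℝ] ℝ) {S : ℕ → Set ℕ}
    (hS : SuccessiveSets S) (s : Finset ℕ) {t : ℝ} (ht : 0 ≤ t)
    (h : ∀ i ∈ s, t < ‖f.comp (proj (S i))‖) :
    t * (s.card : ℝ) ^ (1 / p.conjExponent) ≤ 4 * ‖f‖ := by
  have hp0 : 0 < p := by linarith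
  have hq := Real.HolderConjugate.conjExponent hp
  have hex : ∀ i, ∃ a, tirilmanNorm p γ (restr (S i) a) ≤ 1 ∧
      (i ∈ s → t ≤ f (of (restr (S i) a))) := by
    intro i
    by_cases hi : i ∈ s
    · obtain ⟨a, ha⟩ : ∃ a, t * tirilmanNorm p γ a < |f (of (restr (S i) a))| := by
        by_contra! hcon
        exact not_le.2 (h i hi) (opNorm_comp_proj_le_of_forall ht hcon)
      have hN : 0 < tirilmanNorm p γ a := by
        refine (tirilmanNorm_nonneg a).lt_of_ne fun hz => ?_
        have : a = 0 := (tirilmanNorm_eq_zero_iff hp h0 h1 a).1 hz.symm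
        rw [this, map_zero, map_zero, map_zero, abs_zero, tirilmanNorm_zero, mul_zero] at ha
        exact lt_irrefl _ ha
      obtain ⟨σ, hσ, hσf⟩ : ∃ σ : ℝ, |σ| = 1 ∧
          σ * f (of (restr (S i) a)) = |f (of (restr (S i) a))| := by
        rcases le_total 0 (f (of (restr (S i) a))) with h' | h'
        · exact ⟨1, abs_one, by rw [one_mul, abs_of_nonneg h']⟩
        · exact ⟨-1, by simp, by rw [neg_one_mul, abs_of_nonpos h']⟩
      refine ⟨((tirilmanNorm p γ a)⁻¹ * σ) • a, ?_, fun _ => ?_⟩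
      · rw [map_smul, tirilmanNorm_smul, abs_mul, hσ, mul_one, abs_of_pos (inv_pos.2 hN),
          inv_mul_le_one₀ hN]
        exact tirilmanNorm_restr_le hp h0 h1 _ _
      · rw [map_smul, map_smul, map_smul, smul_eq_mul, mul_assoc, hσf, le_inv_mul_iff₀ hN,
          mul_comm]
        exact ha.le
    · exact ⟨0, by rw [map_zero, tirilmanNorm_zero]; exact zero_le_one, fun h => absurd h hi⟩
  choose a ha1 hat using hex
  have hblocks : SuccessiveBlocks fun i => restr (S i) (a i) := fun i j hij k hk l hl =>
    hS i j hij k (mem_of_restr_ne_zero hk) l (mem_of_restr_ne_zero hl)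
  -- Evaluate `f` on the sum of almost norming vectors, one in each `S i`; the upper `p`-estimate
  -- bounds the norm of this sum.
  have hsum : t * s.card ≤ ‖f‖ * (4 * (s.card : ℝ) ^ (1 / p)) := by
    calc t * s.card = ∑ i ∈ s, t := by rw [Finset.sum_const, nsmul_eq_mul, mul_comm]
      _ ≤ ∑ i ∈ s, f (of (restr (S i) (a i))) := Finset.sum_le_sum fun i hi => hat i hi
      _ = f (of (∑ i ∈ s, restr (S i) (a i))) := by rw [map_sum, map_sum]
      _ ≤ ‖f‖ * ‖(of (∑ i ∈ s, restr (S i) (a i)) : Tirilman p γ hp h0 h1)‖ :=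
          (le_abs_self _).trans (f.le_opNorm _)
      _ ≤ _ := by
        refine mul_le_mul_of_nonneg_left ?_ (norm_nonneg _)
        rw [norm_of]
        refine (tirilmanNorm_sum_le hp h0 hγ hblocks s).trans
          (mul_le_mul_of_nonneg_left (Real.rpow_le_rpow (Finset.sum_nonneg fun i _ =>
            Real.rpow_nonneg (tirilmanNorm_nonneg _) _) ?_ (by positivity)) (by norm_num))
        refine (Finset.sum_le_sum fun i _ =>
          Real.rpow_le_one (tirilmanNorm_nonneg _) (ha1 i) hp0.le).trans_eq ?_
        simp
  rcases Nat.eq_zero_or_pos s.card with hc | hc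
  · rw [hc, Nat.cast_zero, Real.zero_rpow (one_div_pos.2 hq.symm.pos).ne', mul_zero]
    positivity
  · have hc' : (0 : ℝ) < s.card := by exact_mod_cast hc
    have hpos := Real.rpow_pos_of_pos hc' (1 / p)
    have heq : (s.card : ℝ) = (s.card : ℝ) ^ (1 / p.conjExponent) * (s.card : ℝ) ^ (1 / p) := by
      rw [← Real.rpow_add hc', one_div, one_div, add_comm, hq.inv_add_inv_eq_one, Real.rpow_one]
    refine le_of_mul_le_mul_right ?_ hpos
    calc _ = t * s.card := by rw [mul_assoc, ← heq]
      _ ≤ _ := hsum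
      _ = _ := by ring

/-- The unit vector basis is shrinking: otherwise `f` has norm above a fixed bound on infinitely
many successive intervals, against `mul_card_rpow_le`. -/
theorem tendsto_opNorm_comp_proj_Ici (hγ : γ ≤ 1 / 2) (f : Tirilman p γ hp h0 h1 →L[ℝ] ℝ) :
    Tendsto (fun n => ‖f.comp (proj (Set.Ici n))‖) atTop (𝓝 0) := by
  have hq := Real.HolderConjugate.conjExponent hp
  rw [Metric.tendsto_atTop]
  intro δ hδ
  suffices h : ∃ n, ‖f.comp (proj (Set.Ici n))‖ < δ by
    obtain ⟨n, hn⟩ := h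
    refine ⟨n, fun m hm => ?_⟩
    rw [Real.dist_0_eq_abs, abs_norm]
    exact (opNorm_comp_proj_mono f (Set.Ici_subset_Ici.2 hm)).trans_lt hn
  by_contra! hcon
  have hstep : ∀ n, ∃ m, n < m ∧ δ / 2 < ‖f.comp (proj (Set.Ico n m))‖ := by
    intro n
    obtain ⟨a, ha⟩ : ∃ a, δ / 2 * tirilmanNorm p γ a < |f (of (restr (Set.Ici n) a))| := by
      by_contra! hcon'
      have := opNorm_comp_proj_le_of_forall (by positivity) hcon'
      linarith [hcon n]
    refine ⟨a.support.sup id + 1 + n, by omega, ?_⟩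
    by_contra! hle
    rw [restr_Ici_eq_restr_Ico a n (m := a.support.sup id + 1 + n) (by omega), ← proj_of] at ha
    have h2 := (f.comp (proj (Set.Ico n (a.support.sup id + 1 + n)))).le_of_opNorm_le hle (of a)
    rw [norm_of, ContinuousLinearMap.comp_apply, Real.norm_eq_abs] at h2
    exact not_lt.2 h2 ha
  choose m hm hmδ using hstep
  let c : ℕ → ℕ := fun i => Nat.rec 0 (fun _ r => m r) i
  have hc : ∀ i, c (i + 1) = m (c i) := fun i => rfl
  have hmono : Monotone c := monotone_nat_of_le_succ fun i => by rw [hc]; exact (hm _).le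
  have hS : SuccessiveSets fun i => Set.Ico (c i) (c (i + 1)) := fun i j hij x hx y hy =>
    hx.2.trans_le ((hmono hij).trans hy.1)
  have hlim : Tendsto (fun L : ℕ => δ / 2 * (L : ℝ) ^ (1 / p.conjExponent)) atTop atTop :=
    ((tendsto_rpow_atTop (one_div_pos.2 hq.symm.pos)).comp
      tendsto_natCast_atTop_atTop).const_mul_atTop (by positivity)
  obtain ⟨L, hL⟩ := (hlim.eventually_gt_atTop (4 * ‖f‖)).exists
  have := mul_card_rpow_le hγ f hS (Finset.range L) (by positivity : 0 ≤ δ / 2)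
    fun i _ => hmδ (c i)
  rw [Finset.card_range] at this
  exact not_le.2 hL this

theorem proj_Ico_eq_sum {c : ℕ → ℕ} (hc : Monotone c) (L : ℕ) (x : Tirilman p γ hp h0 h1) :
    proj (Set.Ico (c 0) (c L)) x = ∑ i ∈ Finset.range L, proj (Set.Ico (c i) (c (i + 1))) x := by
  induction L with
  | zero => rw [Set.Ico_self, proj_empty, Finset.sum_range_zero]
  | succ L ih =>
    rw [Finset.sum_range_succ, ← ih, proj_add_proj,
      Set.Ico_union_Ico_eq_Ico (hc (Nat.zero_le L)) (hc L.le_succ)]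
    exact Set.disjoint_left.2 fun i hi hi' => not_lt.2 hi'.1 hi.2

/-- A functional with small coordinates can be split into few pieces of small norm. -/
theorem exists_partition (hγ : γ ≤ 1 / 2) (g : Tirilman p γ hp h0 h1 →L[ℝ] ℝ) {t : ℝ}
    (ht : 0 ≤ t) (hg : ∀ i, |g (tirilmanBasis p γ hp h0 h1 i)| ≤ t) {a b : ℕ} (hab : a ≤ b) :
    ∃ (L : ℕ) (c : ℕ → ℕ), Monotone c ∧ c 0 = a ∧ c L = b ∧
      (∀ i < L, ‖g.comp (proj (Set.Ico (c i) (c (i + 1))))‖ ≤ t) ∧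
      t * ((L / 2 : ℕ) : ℝ) ^ (1 / p.conjExponent) ≤ 4 * ‖g‖ := by
  classical
  have hex : ∃ L, ∃ c : ℕ → ℕ, Monotone c ∧ c 0 = a ∧ c L = b ∧
      ∀ i < L, ‖g.comp (proj (Set.Ico (c i) (c (i + 1))))‖ ≤ t := by
    refine ⟨b - a, fun i => a + i, fun i j h => Nat.add_le_add_left h a, rfl, by grind,
      fun i _ => ?_⟩
    have : Set.Ico (a + i) (a + (i + 1)) = (({a + i} : Finset ℕ) : Set ℕ) := by
      ext k
      simp only [Set.mem_Ico, Finset.coe_singleton, Set.mem_singleton_iff]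
      omega
    rw [this]
    refine (opNorm_comp_proj_finset_le g _).trans ?_
    rw [Finset.sum_singleton]
    exact hg _
  -- Take a partition with the fewest intervals; singletons show that one exists. By minimality the
  -- union of intervals `2 * i` and `2 * i + 1` carries norm above `t`, and the `L / 2` such pairs
  -- are successive.
  obtain ⟨c, hc, hca, hcb, hct⟩ := Nat.find_spec hex
  set L := Nat.find hex with hL
  refine ⟨L, c, hc, hca, hcb, hct, ?_⟩
  have hS : SuccessiveSets fun i => Set.Ico (c (2 * i)) (c (2 * i + 2)) := fun i j hij x hx y hy =>
    hx.2.trans_le ((hc (by omega)).trans hy.1)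
  have := mul_card_rpow_le hγ g hS (Finset.range (L / 2)) ht fun i hi => ?_
  · rwa [Finset.card_range] at this
  rw [Finset.mem_range] at hi
  by_contra! hle
  -- Deleting the endpoint `c (2 * i + 1)` merges the two intervals and shortens the partition.
  refine Nat.find_min hex (m := L - 1) (by omega)
    ⟨fun j => if j ≤ 2 * i then c j else c (j + 1), ?_, ?_, ?_, fun j hj => ?_⟩
  · refine monotone_nat_of_le_succ fun j => ?_
    split_ifs <;> exact hc (by omega)
  · simp [hca]
  · beta_reduce
    rw [if_neg (by omega), Nat.sub_add_cancel (by omega), hcb]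
  · beta_reduce
    rcases lt_trichotomy j (2 * i) with h | h | h
    · rw [if_pos h.le, if_pos (by omega)]
      exact hct j (by omega)
    · rw [if_pos h.le, if_neg (by omega), h]
      exact hle
    · rw [if_neg (by omega), if_neg (by omega)]
      exact hct (j + 1) (by omega)

/-- The unit vector basis is dominated by block sequences, in terms of functionals. -/
theorem tirilmanNorm_sum_single_le {f : ℕ → Tirilman p γ hp h0 h1 →L[ℝ] ℝ} {D : ℝ}
    (hf : ∀ k, ‖f k‖ ≤ D) {S : ℕ → Set ℕ} (hS : SuccessiveSets S) (F : Finset ℕ)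
    (x : Tirilman p γ hp h0 h1) :
    tirilmanNorm p γ (∑ k ∈ F, Finsupp.single k (f k (proj (S k) x))) ≤
      D * ‖proj (⋃ k ∈ F, S k) x‖ := by
  classical
  have hD : 0 ≤ D := (norm_nonneg _).trans (hf 0)
  refine ciSup_le fun m => ?_
  -- `F` must vary: restricting the sum to `E i` replaces `F` by its members in `E i`. The
  -- corresponding unions of the `S k` are again successive, so the implicit inequality in `x`
  -- absorbs the average.
  induction m generalizing F with
  | zero =>
    refine ciSup_le fun k => ?_
    rw [Finsupp.finsetSum_apply]
    simp only [Finsupp.single_apply, Finset.sum_ite_eq']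
    split_ifs with hk
    · refine ((f k).le_of_opNorm_le (hf k) _).trans (mul_le_mul_of_nonneg_left ?_ hD)
      exact norm_proj_mono (Set.subset_biUnion_of_mem (u := S) (Finset.mem_coe.2 hk)) x
    · rw [abs_zero]
      positivity
  | succ m ih =>
    refine tirilmanNormAux_succ_le h0 (ih F) fun n E hn hE => ?_
    have hU : SuccessiveSets fun i => ⋃ k ∈ F.filter (· ∈ E i), S k := by
      intro i j hij a ha b hb
      simp only [Set.mem_iUnion, Finset.mem_filter] at ha hb
      obtain ⟨k, ⟨-, hk⟩, hak⟩ := ha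
      obtain ⟨l, ⟨-, hl⟩, hbl⟩ := hb
      exact hS k l (hE.2 i j hij k hk l hl) a hak b hbl
    have hr : ∀ i, restr (E i) (∑ k ∈ F, Finsupp.single k (f k (proj (S k) x))) =
        ∑ k ∈ F.filter (· ∈ E i), Finsupp.single k (f k (proj (S k) x)) := by
      intro i
      rw [map_sum, Finset.sum_filter]
      refine Finset.sum_congr rfl fun k _ => ?_
      ext l
      by_cases hk : k ∈ E i
      · rw [if_pos hk, restr_eq_self]
        intro l hl
        have : l = k := by
          by_contra h
          exact hl (Finsupp.single_eq_of_ne h)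
        rw [this]
        exact_mod_cast hk
      · rw [if_neg hk, Finsupp.zero_apply]
        by_cases hl : l ∈ (E i : Set ℕ)
        · rw [restr_of_mem hl]
          refine Finsupp.single_eq_of_ne ?_
          rintro rfl
          exact hk (by exact_mod_cast hl)
        · exact restr_of_notMem hl _
    have hsub : ∀ i, proj (⋃ k ∈ F.filter (· ∈ E i), S k) x =
        proj (⋃ k ∈ F.filter (· ∈ E i), S k) (proj (⋃ k ∈ F, S k) x) := by
      intro i
      rw [proj_proj, Set.inter_eq_self_of_subset_left]
      exact Set.biUnion_subset_biUnion_left fun k hk => (Finset.mem_filter.1 hk).1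
    calc _ ≤ γ * ∑ i, D * ‖proj (⋃ k ∈ F.filter (· ∈ E i), S k) (proj (⋃ k ∈ F, S k) x)‖ := by
          refine mul_le_mul_of_nonneg_left (Finset.sum_le_sum fun i _ => ?_) h0.le
          rw [hr, ← hsub]
          exact ih _
      _ = D * (γ * ∑ i, ‖proj (⋃ k ∈ F.filter (· ∈ E i), S k) (proj (⋃ k ∈ F, S k) x)‖) := by
          rw [← Finset.mul_sum]; ring
      _ ≤ D * ((n : ℝ) ^ (1 / p.conjExponent) * ‖proj (⋃ k ∈ F, S k) x‖) :=
          mul_le_mul_of_nonneg_left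
            ((sum_norm_proj_le _ Finset.univ hU).trans_eq (by simp)) hD
      _ = _ := by ring

end Tirilman


/-! ### Subsymmetric bases -/

section Basis

variable {Y : Type*} [NormedAddCommGroup Y] [NormedSpace ℝ Y]

theorem SeriesConverges.tendsto_zero {x : ℕ → Y} {a : ℕ → ℝ} (h : SeriesConverges x a) :
    Tendsto (fun n => a n • x n) atTop (𝓝 0) := by
  obtain ⟨s, hs⟩ := h
  have := (hs.comp (tendsto_add_atTop_nat 1)).sub hs
  simpa [Finset.sum_range_succ] using this

theorem seriesConverges_of_summable {x : ℕ → Y} {a : ℕ → ℝ}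
    (h : Summable fun n => a n • x n) : SeriesConverges x a :=
  ⟨_, h.hasSum.tendsto_sum_nat⟩

theorem SeriesConverges.add {x : ℕ → Y} {a a' : ℕ → ℝ} (h : SeriesConverges x a)
    (h' : SeriesConverges x a') : SeriesConverges x fun n => a n + a' n := by
  obtain ⟨s, hs⟩ := h
  obtain ⟨s', hs'⟩ := h'
  refine ⟨s + s', ?_⟩
  simpa only [add_smul, Finset.sum_add_distrib] using hs.add hs'

theorem exists_strictMono_of_not_bddAbove {u : ℕ → ℝ} (hu : ¬ BddAbove (Set.range u))
    (C : ℕ → ℝ) : ∃ φ : ℕ → ℕ, StrictMono φ ∧ ∀ k, C k ≤ u (φ k) := by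
  refine extraction_forall_of_frequently (P := fun k j => C k ≤ u j) fun k => ?_
  by_contra h
  rw [not_frequently] at h
  refine hu (IsBoundedUnder.bddAbove_range ⟨C k, ?_⟩)
  rw [eventually_map]
  exact h.mono fun n hn => (not_le.1 hn).le

variable (b : SchauderBasis ℝ Y)

theorem coord_basis_self (k : ℕ) : b.coord k (b k) = 1 := by
  simp [b.ortho]

theorem coord_basis_of_ne {j k : ℕ} (h : k ≠ j) : b.coord k (b j) = 0 := by
  simp [b.ortho, h]

theorem basis_ne_zero (k : ℕ) : b k ≠ 0 := by
  intro h
  have := coord_basis_self b k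
  rw [h, map_zero] at this
  exact zero_ne_one this

variable {b}

theorem coord_eq_of_tendsto {φ : ℕ → ℕ} (hφ : Function.Injective φ) {a : ℕ → ℝ} {y : Y}
    (h : Tendsto (fun n => ∑ j ∈ Finset.range n, a j • (b ∘ φ) j) atTop (𝓝 y)) (k : ℕ) :
    b.coord (φ k) y = a k := by
  refine tendsto_nhds_unique (((b.coord (φ k)).continuous.tendsto y).comp h)
    (tendsto_const_nhds.congr' ?_)
  filter_upwards [eventually_gt_atTop k] with n hn
  simp only [Function.comp_apply, map_sum, map_smul, smul_eq_mul]
  rw [Finset.sum_eq_single k]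
  · rw [coord_basis_self, mul_one]
  · intro j _ hj
    rw [coord_basis_of_ne b fun h => hj (hφ h).symm, mul_zero]
  · intro h
    exact absurd (Finset.mem_range.2 hn) h

theorem seriesConverges_coord (y : Y) : SeriesConverges b fun j => b.coord j y :=
  ⟨y, by simpa using SchauderBasis.tendsto_proj b y⟩

/-- Equivalence is only a statement about convergence, so boundedness needs an argument. Were the
norms unbounded, a fast growing subsequence would turn an absolutely convergent series into one
whose terms have norm at least 1. -/
theorem IsSubsymmetric.exists_norm_le [CompleteSpace Y] (hb : IsSubsymmetric b) :
    ∃ D, ∀ j, ‖b j‖ ≤ D := by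
  by_contra! hcon
  have hnb : ¬ BddAbove (Set.range fun j => ‖b j‖) := by
    rintro ⟨D, hD⟩
    obtain ⟨j, hj⟩ := hcon D
    exact not_le.2 hj (hD ⟨j, rfl⟩)
  obtain ⟨φ, hφ, hle⟩ := exists_strictMono_of_not_bddAbove hnb fun k => 2 ^ k * ‖b k‖
  have hpos : ∀ k, 0 < ‖b k‖ := fun k => norm_pos_iff.2 (basis_ne_zero b k)
  have hconv : SeriesConverges b fun k => (1 / 2) ^ k * ‖b k‖⁻¹ := by
    refine seriesConverges_of_summable (Summable.of_norm ?_)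
    refine summable_geometric_two.congr fun k => ?_
    rw [norm_smul, Real.norm_eq_abs, abs_of_nonneg (by positivity), mul_assoc,
      inv_mul_cancel₀ (hpos k).ne', mul_one]
  have h := ((hb.subsequences φ hφ _).1 hconv).tendsto_zero.norm
  rw [norm_zero] at h
  obtain ⟨k, hk⟩ := (h.eventually_lt_const one_pos).exists
  rw [norm_smul, Real.norm_eq_abs, abs_of_nonneg (by have := hpos k; positivity)] at hk
  refine not_le.2 hk ?_
  calc (1 : ℝ) = (1 / 2) ^ k * ‖b k‖⁻¹ * (2 ^ k * ‖b k‖) := by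
        have := (hpos k).ne'
        rw [one_div, inv_pow]
        field_simp
    _ ≤ _ := mul_le_mul_of_nonneg_left (hle k) (by have := hpos k; positivity)

/-- The mirror image: along a subsequence with rapidly decreasing norms the coefficients `‖b k‖⁻¹`
give an absolutely convergent series, but against `b` itself its terms have norm 1. -/
theorem IsSubsymmetric.exists_le_norm [CompleteSpace Y] (hb : IsSubsymmetric b) :
    ∃ C, ∀ j, ‖b j‖⁻¹ ≤ C := by
  by_contra! hcon
  have hnb : ¬ BddAbove (Set.range fun j => ‖b j‖⁻¹) := by
    rintro ⟨D, hD⟩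
    obtain ⟨j, hj⟩ := hcon D
    exact not_le.2 hj (hD ⟨j, rfl⟩)
  obtain ⟨φ, hφ, hle⟩ := exists_strictMono_of_not_bddAbove hnb fun k => 2 ^ k * ‖b k‖⁻¹
  have hpos : ∀ k, 0 < ‖b k‖ := fun k => norm_pos_iff.2 (basis_ne_zero b k)
  have hconv : SeriesConverges (b ∘ φ) fun k => ‖b k‖⁻¹ := by
    refine seriesConverges_of_summable
      (Summable.of_norm_bounded summable_geometric_two fun k => ?_)
    rw [norm_smul, norm_inv, norm_norm, Function.comp_apply]
    calc ‖b k‖⁻¹ * ‖b (φ k)‖ = (1 / 2) ^ k * (2 ^ k * ‖b k‖⁻¹) * ‖b (φ k)‖ := by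
          rw [← mul_assoc, ← mul_pow]; norm_num
      _ ≤ (1 / 2) ^ k * ‖b (φ k)‖⁻¹ * ‖b (φ k)‖ := by
          gcongr
          exact hle k
      _ = _ := by rw [mul_assoc, inv_mul_cancel₀ (hpos _).ne', mul_one]
  have h := ((hb.subsequences φ hφ _).2 hconv).tendsto_zero.norm
  have h1 : ∀ k, ‖‖b k‖⁻¹ • b k‖ = 1 := fun k => by
    rw [norm_smul, norm_inv, norm_norm, inv_mul_cancel₀ (hpos k).ne']
  simp only [h1, norm_zero] at h
  exact one_ne_zero (tendsto_nhds_unique tendsto_const_nhds h)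

theorem IsSubsymmetric.tendsto_coord [CompleteSpace Y] (hb : IsSubsymmetric b) (y : Y) :
    Tendsto (fun j => b.coord j y) atTop (𝓝 0) := by
  obtain ⟨C, hC⟩ := hb.exists_le_norm
  have h := ((seriesConverges_coord (b := b) y).tendsto_zero.norm.mul_const C)
  rw [norm_zero, zero_mul] at h
  refine squeeze_zero_norm (fun j => ?_) h
  have hpos : 0 < ‖b j‖ := norm_pos_iff.2 (basis_ne_zero b j)
  rw [norm_smul, mul_assoc]
  refine le_mul_of_one_le_right (norm_nonneg _) ?_
  rw [← mul_inv_cancel₀ hpos.ne']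
  exact mul_le_mul_of_nonneg_left (hC j) hpos.le

theorem IsSubsymmetric.exists_norm_coord_le [CompleteSpace Y] (hb : IsSubsymmetric b) :
    ∃ D, ∀ j, ‖b.coord j‖ ≤ D := by
  refine banach_steinhaus fun y => ?_
  obtain ⟨C, hC⟩ := isBounded_iff_forall_norm_le.1
    (Metric.isBounded_range_of_tendsto _ (hb.tendsto_coord y))
  exact ⟨C, fun j => hC _ ⟨j, rfl⟩⟩

end Basis

namespace Tirilman

variable {hp : 1 < p} {h0 : 0 < γ} {h1 : γ < 1}

/-! ### Functionals close to a block sequence -/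

/-- The functionals `f k` are close to functionals supported in successive intervals. -/
structure BlockApprox (f : ℕ → Tirilman p γ hp h0 h1 →L[ℝ] ℝ) (l r : ℕ → ℕ) (ε : ℝ) : Prop where
  lt : ∀ k, l k < r k
  le : ∀ k, r k ≤ l (k + 1)
  close : ∀ k, ‖f k - (f k).comp (proj (Set.Ico (l k) (r k)))‖ ≤ ε * (1 / 2) ^ k

namespace BlockApprox

variable {f : ℕ → Tirilman p γ hp h0 h1 →L[ℝ] ℝ} {l r : ℕ → ℕ} {ε : ℝ}

theorem strictMono (h : BlockApprox f l r ε) : StrictMono l :=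
  strictMono_nat_of_lt_succ fun k => (h.lt k).trans_le (h.le k)

theorem successiveSets (h : BlockApprox f l r ε) :
    SuccessiveSets fun k => Set.Ico (l k) (r k) := fun i _ hij _ hx _ hy =>
  hx.2.trans_le ((h.le i).trans ((h.strictMono.monotone hij).trans hy.1))

theorem nonneg (h : BlockApprox f l r ε) : 0 ≤ ε := by
  simpa using (norm_nonneg _).trans (h.close 0)

theorem comp (h : BlockApprox f l r ε) {ψ : ℕ → ℕ} (hψ : StrictMono ψ) :
    BlockApprox (f ∘ ψ) (l ∘ ψ) (r ∘ ψ) ε where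
  lt k := h.lt _
  le k := (h.le _).trans (h.strictMono.monotone (hψ k.lt_succ_self))
  close k := (h.close _).trans (mul_le_mul_of_nonneg_left
    (pow_le_pow_of_le_one (by norm_num) (by norm_num) hψ.le_apply) h.nonneg)

theorem abs_sub_le (h : BlockApprox f l r ε) (k : ℕ) (x : Tirilman p γ hp h0 h1) :
    |f k x - f k (proj (Set.Ico (l k) (r k)) x)| ≤ ε * (1 / 2) ^ k * ‖x‖ :=
  (f k - (f k).comp (proj (Set.Ico (l k) (r k)))).le_of_opNorm_le (h.close k) x

end BlockApprox

/-- A gliding hump: pointwise convergence to zero makes the part before `n` small for a late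
functional, and shrinkingness makes its tail small. -/
theorem exists_blockApprox (hγ : γ ≤ 1 / 2) {f : ℕ → Tirilman p γ hp h0 h1 →L[ℝ] ℝ}
    (hf : ∀ x, Tendsto (fun j => f j x) atTop (𝓝 0)) {ε : ℝ} (hε : 0 < ε) :
    ∃ φ : ℕ → ℕ, StrictMono φ ∧ ∃ l r, BlockApprox (f ∘ φ) l r ε := by
  have hstep : ∀ k j n : ℕ, ∃ j' n', j < j' ∧ n < n' ∧
      ‖f j' - (f j').comp (proj (Set.Ico n n'))‖ ≤ ε * (1 / 2) ^ k := by
    intro k j n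
    have hε' : 0 < ε * (1 / 2) ^ k / 2 := by positivity
    have ht : Tendsto (fun j => ∑ i ∈ Finset.range n, |f j (tirilmanBasis p γ hp h0 h1 i)|) atTop
        (𝓝 0) := by
      simpa using tendsto_finsetSum (Finset.range n) fun i _ =>
        (hf (tirilmanBasis p γ hp h0 h1 i)).abs
    obtain ⟨j', hj', hjj'⟩ := ((ht.eventually_lt_const hε').and (eventually_gt_atTop j)).exists
    obtain ⟨n', hn', hnn'⟩ := (((tendsto_opNorm_comp_proj_Ici hγ (f j')).eventually_lt_const
      hε').and (eventually_gt_atTop n)).exists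
    refine ⟨j', n', hjj', hnn', ?_⟩
    have heq : f j' - (f j').comp (proj (Set.Ico n n')) =
        (f j').comp (proj ((Finset.range n : Finset ℕ) : Set ℕ)) +
          (f j').comp (proj (Set.Ici n')) := by
      ext x
      have h2 : x = proj (Set.Ico n n') x + (proj ((Finset.range n : Finset ℕ) : Set ℕ) x +
          proj (Set.Ici n') x) := by
        rw [proj_add_proj, proj_add_proj]
        · conv_lhs => rw [← proj_univ x]
          congr 2
          ext i
          simp
          omega
        · rw [Set.disjoint_left]
          intro i
          simp
        · rw [Set.disjoint_left]
          intro i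
          simp
          omega
      have h3 := congrArg (f j') h2
      simp only [map_add] at h3
      simp only [_root_.sub_apply, _root_.add_apply, ContinuousLinearMap.comp_apply]
      linarith
    rw [heq]
    have := opNorm_comp_proj_finset_le (f j') (Finset.range n)
    linarith [norm_add_le ((f j').comp (proj ((Finset.range n : Finset ℕ) : Set ℕ)))
      ((f j').comp (proj (Set.Ici n')))]
  choose J N hJ hN hclose using hstep
  let s : ℕ → ℕ × ℕ := fun k => Nat.rec (0, 0) (fun k s => (J k s.1 s.2, N k s.1 s.2)) k
  have hs : ∀ k, s (k + 1) = (J k (s k).1 (s k).2, N k (s k).1 (s k).2) := fun k => rfl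
  -- The index shift skips the starting value `s 0`, whose first entry was not selected by the
  -- construction; its second entry is only the left end of the first interval.
  refine ⟨fun k => (s (k + 1)).1, strictMono_nat_of_lt_succ fun k => ?_, fun k => (s k).2,
    fun k => (s (k + 1)).2, fun k => ?_, fun k => le_rfl, fun k => ?_⟩
  · rw [hs (k + 1)]
    exact hJ _ _ _
  · rw [hs k]
    exact hN _ _ _
  · simp only [Function.comp_apply, hs k]
    exact hclose _ _ _

/-! ### Convergence of series in the unit vectors -/

theorem norm_basis_le (j : ℕ) : ‖tirilmanBasis p γ hp h0 h1 j‖ ≤ 1 := by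
  classical
  rw [← of_single, norm_of]
  refine (tirilmanNorm_le_sum hp h0 h1 _).trans_eq ?_
  rw [Finsupp.support_single _ one_ne_zero, Finset.sum_singleton, Finsupp.single_eq_same,
    abs_one]

theorem sum_smul_basis (F : Finset ℕ) (a : ℕ → ℝ) (i : ℕ → ℕ) :
    ∑ j ∈ F, a j • tirilmanBasis p γ hp h0 h1 (i j) =
      of (∑ j ∈ F, Finsupp.single (i j) (a j)) := by
  rw [map_sum]
  refine Finset.sum_congr rfl fun j _ => ?_
  rw [← of_single, ← map_smul, Finsupp.smul_single, smul_eq_mul, mul_one]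

theorem seriesConverges_of_norm_le {Z : Type*} [NormedAddCommGroup Z] [NormedSpace ℝ Z]
    [CompleteSpace Z] {x : ℕ → Z} {a : ℕ → ℝ} {B : ℕ → ℝ} (hB : Tendsto B atTop (𝓝 0))
    (h : ∀ m n, m ≤ n → ‖∑ j ∈ Finset.Ico m n, a j • x j‖ ≤ B m) : SeriesConverges x a := by
  refine cauchySeq_tendsto_of_complete (cauchySeq_of_le_tendsto_0' B (fun m n hmn => ?_) hB)
  rw [dist_eq_norm', ← Finset.sum_Ico_eq_sub _ hmn]
  exact h m n hmn

/-- For the localized functionals, `tirilmanNorm_sum_single_le` bounds segments of the series by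
tails of `x`; the localization errors are absolutely summable. -/
theorem BlockApprox.seriesConverges_basis {f : ℕ → Tirilman p γ hp h0 h1 →L[ℝ] ℝ} {l r : ℕ → ℕ}
    {ε : ℝ} (h : BlockApprox f l r ε) {D : ℝ} (hD : ∀ k, ‖f k‖ ≤ D)
    (x : Tirilman p γ hp h0 h1) :
    SeriesConverges (tirilmanBasis p γ hp h0 h1) fun k => f k x := by
  have hD0 : 0 ≤ D := (norm_nonneg _).trans (hD 0)
  have h2 : SeriesConverges (tirilmanBasis p γ hp h0 h1)
      fun k => f k (proj (Set.Ico (l k) (r k)) x) := by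
    have hlim : Tendsto (fun m => D * ‖proj (Set.Ici (l m)) x‖) atTop (𝓝 0) := by
      simpa using ((tendsto_norm_proj_Ici x).comp h.strictMono.tendsto_atTop).const_mul D
    refine seriesConverges_of_norm_le hlim fun m n _ => ?_
    refine (congrArg norm (sum_smul_basis (Finset.Ico m n) _ id)).trans_le ?_
    rw [norm_of]
    refine (tirilmanNorm_sum_single_le hD h.successiveSets _ x).trans
      (mul_le_mul_of_nonneg_left (norm_proj_mono ?_ x) hD0)
    refine Set.iUnion₂_subset fun k hk i hi => ?_
    exact (h.strictMono.monotone (Finset.mem_Ico.1 hk).1).trans hi.1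
  have h3 : SeriesConverges (tirilmanBasis p γ hp h0 h1)
      fun k => f k x - f k (proj (Set.Ico (l k) (r k)) x) := by
    refine seriesConverges_of_summable (Summable.of_norm_bounded
      ((summable_geometric_two.mul_left ε).mul_right ‖x‖) fun k => ?_)
    rw [norm_smul]
    exact (mul_le_of_le_one_right (norm_nonneg _) (norm_basis_le k)).trans (h.abs_sub_le k x)
  simpa using h2.add h3

theorem proj_basis_of_notMem {S : Set ℕ} {i : ℕ} (hi : i ∉ S) :
    proj S (tirilmanBasis p γ hp h0 h1 i) = 0 := by
  rw [← of_single, proj_of, ← map_zero of]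
  congr 1
  ext k
  by_cases hk : k ∈ S
  · rw [restr_of_mem hk, Finsupp.single_eq_of_ne, Finsupp.zero_apply]
    rintro rfl
    exact hi hk
  · exact restr_of_notMem hk _

theorem proj_basis_of_mem {S : Set ℕ} {i : ℕ} (hi : i ∈ S) :
    proj S (tirilmanBasis p γ hp h0 h1 i) = tirilmanBasis p γ hp h0 h1 i := by
  rw [← of_single, proj_of, restr_eq_self]
  intro k hk
  have : k = i := by
    by_contra h
    exact hk (Finsupp.single_eq_of_ne h)
  rwa [this]

/-- Convergence along a subsequence of the unit vectors, with coefficients which may decrease. -/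
theorem seriesConverges_spread {a c : ℕ → ℝ} {δ : ℝ} (hδ : 0 ≤ δ)
    (hca : ∀ k, |c k| ≤ δ * |a k|) {i : ℕ → ℕ} (hi : StrictMono i)
    (h : SeriesConverges (tirilmanBasis p γ hp h0 h1) a) :
    SeriesConverges (tirilmanBasis p γ hp h0 h1 ∘ i) c := by
  classical
  obtain ⟨s, hs⟩ := h
  have hC := Metric.cauchySeq_iff'.1 hs.cauchySeq
  refine cauchySeq_tendsto_of_complete (Metric.cauchySeq_iff'.2 fun ε hε => ?_)
  obtain ⟨m, hm⟩ := hC (ε / (δ + 1)) (by positivity)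
  refine ⟨m, fun n hn => ?_⟩
  have h2 := hm n hn
  rw [dist_eq_norm, ← Finset.sum_Ico_eq_sub _ hn] at h2 ⊢
  have e1 := congrArg norm (sum_smul_basis (hp := hp) (h0 := h0) (h1 := h1) (Finset.Ico m n) a id)
  have e2 := congrArg norm (sum_smul_basis (hp := hp) (h0 := h0) (h1 := h1) (Finset.Ico m n) c i)
  simp only [id] at e1
  simp only [Function.comp_apply]
  rw [e1, norm_of] at h2
  rw [e2, norm_of]
  have hle : tirilmanNorm p γ (∑ j ∈ Finset.Ico m n, Finsupp.single (i j) (c j)) ≤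
      tirilmanNorm p γ (δ • ∑ j ∈ Finset.Ico m n, Finsupp.single j (a j)) := by
    refine tirilmanNorm_le_of_spread hp h0 h1 hi fun k hk => ?_
    obtain ⟨j, hj, hjk⟩ : ∃ j ∈ Finset.Ico m n, i j = k := by
      by_contra! hcon
      refine hk ?_
      rw [Finsupp.finsetSum_apply]
      exact Finset.sum_eq_zero fun j hj => Finsupp.single_eq_of_ne (hcon j hj).symm
    refine ⟨j, hjk, ?_⟩
    subst hjk
    rw [Finsupp.smul_apply, Finsupp.finsetSum_apply, Finsupp.finsetSum_apply]
    simp only [Finsupp.single_apply, hi.injective.eq_iff, Finset.sum_ite_eq', hj, if_true]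
    rw [smul_eq_mul, abs_mul, abs_of_nonneg hδ]
    exact hca j
  rw [tirilmanNorm_smul, abs_of_nonneg hδ] at hle
  have hN := tirilmanNorm_nonneg (p := p) (γ := γ) (∑ j ∈ Finset.Ico m n, Finsupp.single j (a j))
  rw [lt_div_iff₀ (by positivity)] at h2
  nlinarith

/-! ### Comparison of the unit vectors with a basis of a quotient -/

variable {Y : Type*} [NormedAddCommGroup Y] [NormedSpace ℝ Y] [CompleteSpace Y]
  {b : SchauderBasis ℝ Y} {Q : Tirilman p γ hp h0 h1 →L[ℝ] Y}

/-- A subsymmetric basis of a quotient dominates the unit vector basis. -/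
theorem seriesConverges_basis_of_quotient (hγ : γ ≤ 1 / 2) (hb : IsSubsymmetric b)
    (hQ : Function.Surjective Q) {a : ℕ → ℝ} (ha : SeriesConverges b a) :
    SeriesConverges (tirilmanBasis p γ hp h0 h1) a := by
  obtain ⟨φ, hφ, l, r, h⟩ := exists_blockApprox hγ (f := fun j => (b.coord j).comp Q)
    (fun x => hb.tendsto_coord (Q x)) one_pos
  obtain ⟨D, hD⟩ := hb.exists_norm_coord_le
  -- Placing the coefficients along `φ` makes them the values of the block-like functionals at any
  -- lift of `y`.
  obtain ⟨y, hy⟩ := (hb.subsequences φ hφ a).1 ha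
  obtain ⟨x, rfl⟩ := hQ y
  have hx := h.seriesConverges_basis (D := D * ‖Q‖) (fun k =>
    (ContinuousLinearMap.opNorm_comp_le _ _).trans
      (mul_le_mul_of_nonneg_right (hD _) (norm_nonneg _))) x
  convert hx using 2 with k
  exact (coord_eq_of_tendsto hφ.injective hy k).symm

/-- The case of coordinate functionals with coordinates bounded away from zero. -/
theorem seriesConverges_of_large_coordinates (hb : IsSubsymmetric b) {φ : ℕ → ℕ}
    (hφ : StrictMono φ) {l r : ℕ → ℕ} {ε : ℝ}
    (h : BlockApprox (fun k => (b.coord (φ k)).comp Q) l r ε) {i : ℕ → ℕ}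
    (hi : ∀ k, i k ∈ Set.Ico (l k) (r k)) {δ : ℝ} (hδ : 0 < δ)
    (hlarge : ∀ k, δ ≤ |b.coord (φ k) (Q (tirilmanBasis p γ hp h0 h1 (i k)))|) {a : ℕ → ℝ}
    (ha : SeriesConverges (tirilmanBasis p γ hp h0 h1) a) : SeriesConverges b a := by
  set d : ℕ → ℝ := fun k => b.coord (φ k) (Q (tirilmanBasis p γ hp h0 h1 (i k))) with hd
  have hd0 : ∀ k, d k ≠ 0 := fun k hk => by
    have := hlarge k
    rw [show b.coord (φ k) (Q (tirilmanBasis p γ hp h0 h1 (i k))) = 0 from hk, abs_zero] at this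
    linarith
  have himono : StrictMono i := fun j k hjk => h.successiveSets j k hjk _ (hi j) _ (hi k)
  obtain ⟨x, hx⟩ := seriesConverges_spread (c := fun k => a k / d k) (δ := δ⁻¹) (by positivity)
    (fun k => by
      rw [abs_div, div_eq_inv_mul]
      exact mul_le_mul_of_nonneg_right (inv_anti₀ hδ (hlarge k)) (abs_nonneg _)) himono ha
  have hcoord : ∀ k, b.coord (φ k) (Q (proj (Set.Ico (l k) (r k)) x)) = a k := by
    intro k
    refine tendsto_nhds_unique (((((b.coord (φ k)).comp Q).comp
      (proj (Set.Ico (l k) (r k)))).continuous.tendsto x).comp hx) (tendsto_const_nhds.congr' ?_)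
    filter_upwards [eventually_gt_atTop k] with n hn
    simp only [Function.comp_apply, map_sum, map_smul, smul_eq_mul,
      ContinuousLinearMap.comp_apply]
    rw [Finset.sum_eq_single k]
    · rw [proj_basis_of_mem (hi k)]
      exact (div_mul_cancel₀ _ (hd0 k)).symm
    · intro j _ hj
      rw [proj_basis_of_notMem, map_zero, map_zero, mul_zero]
      intro hjk
      rcases lt_or_gt_of_ne hj with h' | h'
      · exact lt_irrefl _ (h.successiveSets _ _ h' _ (hi j) _ hjk)
      · exact lt_irrefl _ (h.successiveSets _ _ h' _ hjk _ (hi j))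
    · intro h
      exact absurd (Finset.mem_range.2 hn) h
  obtain ⟨D, hD⟩ := hb.exists_norm_le
  -- Unconditionality keeps only the coordinates of `Q x` along `φ`. These differ from `a k` by a
  -- summable error.
  have hs1 : Summable fun k => b.coord (φ k) (Q x) • b (φ k) :=
    (hb.unconditional _ (seriesConverges_coord (Q x))).comp_injective hφ.injective
  have hs2 : Summable fun k => (b.coord (φ k) (Q x) - a k) • b (φ k) := by
    refine Summable.of_norm_bounded
      (((summable_geometric_two.mul_left ε).mul_right ‖x‖).mul_right D) fun k => ?_
    have h2 := h.abs_sub_le k x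
    simp only [ContinuousLinearMap.comp_apply, hcoord] at h2
    rw [norm_smul]
    exact mul_le_mul h2 (hD _) (norm_nonneg _) ((abs_nonneg _).trans h2)
  refine (hb.subsequences φ hφ a).2 (seriesConverges_of_summable ((hs1.sub hs2).congr fun k => ?_))
  rw [← sub_smul, sub_sub_cancel, Function.comp_apply]

end Tirilman


namespace Tirilman

variable {hp : 1 < p} {h0 : 0 < γ} {h1 : γ < 1}

/-! ### Coordinate functionals with small coordinates -/

theorem abs_apply_proj_le_sum {g : Tirilman p γ hp h0 h1 →L[ℝ] ℝ} {c : ℕ → ℕ} (hc : Monotone c)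
    {L : ℕ} {t : ℝ} (h : ∀ i < L, ‖g.comp (proj (Set.Ico (c i) (c (i + 1))))‖ ≤ t)
    (x : Tirilman p γ hp h0 h1) :
    |g (proj (Set.Ico (c 0) (c L)) x)| ≤
      t * ∑ i ∈ Finset.range L, ‖proj (Set.Ico (c i) (c (i + 1))) x‖ := by
  rw [proj_Ico_eq_sum hc, map_sum, Finset.mul_sum]
  refine (Finset.abs_sum_le_sum_abs _ _).trans (Finset.sum_le_sum fun i hi => ?_)
  have h2 := (g.comp (proj (Set.Ico (c i) (c (i + 1))))).le_of_opNorm_le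
    (h i (Finset.mem_range.1 hi)) (proj (Set.Ico (c i) (c (i + 1))) x)
  rwa [ContinuousLinearMap.comp_apply, proj_proj, Set.inter_self] at h2

/-- All pieces of all partitions form one successive family in lexicographic order. Averaging over
it at once gives the `1/q` power of the total number of pieces, which is better than treating each
`k` separately. -/
theorem sum_sum_norm_proj_le {F : Finset ℕ} {c : ℕ → ℕ → ℕ} {L : ℕ → ℕ}
    (hc : ∀ k, Monotone (c k)) (hS : ∀ j k, j < k → c j (L j) ≤ c k 0)
    (x : Tirilman p γ hp h0 h1) :
    γ * ∑ k ∈ F, ∑ i ∈ Finset.range (L k), ‖proj (Set.Ico (c k i) (c k (i + 1))) x‖ ≤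
      ((∑ k ∈ F, L k : ℕ) : ℝ) ^ (1 / p.conjExponent) * ‖x‖ := by
  let S : Lex (ℕ × ℕ) → Set ℕ := fun z =>
    if (ofLex z).2 < L (ofLex z).1 then
      Set.Ico (c (ofLex z).1 (ofLex z).2) (c (ofLex z).1 ((ofLex z).2 + 1)) else ∅
  have hSS : SuccessiveSets S := by
    intro z w hzw a ha b hb
    by_cases hz : (ofLex z).2 < L (ofLex z).1
    swap
    · simp only [S, if_neg hz] at ha; exact absurd ha (Set.notMem_empty a)
    by_cases hw : (ofLex w).2 < L (ofLex w).1
    swap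
    · simp only [S, if_neg hw] at hb; exact absurd hb (Set.notMem_empty b)
    simp only [S, if_pos hz, Set.mem_Ico] at ha
    simp only [S, if_pos hw, Set.mem_Ico] at hb
    rcases Prod.Lex.lt_iff.1 hzw with h | ⟨h, h'⟩
    · exact ha.2.trans_le ((hc _ hz).trans ((hS _ _ h).trans ((hc _ (Nat.zero_le _)).trans hb.1)))
    · rw [← h] at hb
      exact ha.2.trans_le ((hc _ h').trans hb.1)
  let s : Finset (Lex (ℕ × ℕ)) :=
    (F.sigma fun k => Finset.range (L k)).map
      ⟨fun z => toLex (z.1, z.2), fun z w h => by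
        obtain ⟨z1, z2⟩ := z
        obtain ⟨w1, w2⟩ := w
        have := toLex.injective h
        simp only [Prod.mk.injEq] at this
        obtain ⟨rfl, rfl⟩ := this
        rfl⟩
  have h := sum_norm_proj_le x s hSS
  have hcard : s.card = ∑ k ∈ F, L k := by
    simp [s, Finset.card_map, Finset.card_sigma]
  rw [hcard, Finset.sum_map, Finset.sum_sigma] at h
  refine le_trans (le_of_eq ?_) h
  congr 1
  refine Finset.sum_congr rfl fun k _ => Finset.sum_congr rfl fun i hi => ?_
  have hSki : S (toLex (k, i)) = Set.Ico (c k i) (c k (i + 1)) := if_pos (Finset.mem_range.1 hi)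
  exact congrArg (fun T => ‖proj T x‖) hSki.symm

/-- An upper estimate for functionals supported in successive intervals, with small coordinates. -/
theorem sum_mul_abs_apply_le (hγ : γ ≤ 1 / 2) {f : ℕ → Tirilman p γ hp h0 h1 →L[ℝ] ℝ} {D : ℝ}
    (hD : ∀ k, ‖f k‖ ≤ D) {l r : ℕ → ℕ} (hl : StrictMono l) (hlr : ∀ k, l k ≤ r k)
    (hrl : ∀ k, r k ≤ l (k + 1)) (F : Finset ℕ) {β : ℕ → ℝ} (hβ : ∀ k ∈ F, 0 < β k) {τ : ℝ}
    (hτ : 0 < τ)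
    (hsmall : ∀ k ∈ F, ∀ i, |f k (proj (Set.Ico (l k) (r k)) (tirilmanBasis p γ hp h0 h1 i))| ≤
      τ / β k) (x : Tirilman p γ hp h0 h1) :
    γ * ∑ k ∈ F, β k * |f k (proj (Set.Ico (l k) (r k)) x)| ≤
      (2 * (4 * D) ^ p.conjExponent * ∑ k ∈ F, β k ^ p.conjExponent +
        τ ^ p.conjExponent * F.card) ^ (1 / p.conjExponent) * ‖x‖ := by
  have hq := (Real.HolderConjugate.conjExponent hp).symm
  have hq0 := hq.pos
  set q := p.conjExponent with hqdef
  have hD0 : 0 ≤ D := (norm_nonneg _).trans (hD 0)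
  have hex : ∀ k, ∃ (L : ℕ) (c : ℕ → ℕ), Monotone c ∧ c 0 = l k ∧ c L = r k ∧
      (k ∈ F → (∀ i < L, ‖((f k).comp (proj (Set.Ico (l k) (r k)))).comp
        (proj (Set.Ico (c i) (c (i + 1))))‖ ≤ τ / β k) ∧
        τ / β k * ((L / 2 : ℕ) : ℝ) ^ (1 / q) ≤ 4 * D) := by
    intro k
    by_cases hk : k ∈ F
    · obtain ⟨L, c, hc, hc0, hcL, hct, hL⟩ := exists_partition hγ
        ((f k).comp (proj (Set.Ico (l k) (r k)))) (div_pos hτ (hβ k hk)).le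
        (fun i => hsmall k hk i) (hlr k)
      refine ⟨L, c, hc, hc0, hcL, fun _ => ⟨hct, hL.trans ?_⟩⟩
      exact mul_le_mul_of_nonneg_left ((opNorm_comp_proj_le _ _).trans (hD k)) (by norm_num)
    · exact ⟨1, fun i => if i = 0 then l k else r k, monotone_nat_of_le_succ fun i => by
        simp only [Nat.succ_ne_zero, if_false]
        split_ifs
        exacts [hlr k, le_rfl], by simp, by simp, fun h => absurd h hk⟩
  choose L c hc hc0 hcL hF using hex
  have hpieces : ∑ k ∈ F, β k * |f k (proj (Set.Ico (l k) (r k)) x)| ≤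
      τ * ∑ k ∈ F, ∑ i ∈ Finset.range (L k), ‖proj (Set.Ico (c k i) (c k (i + 1))) x‖ := by
    rw [Finset.mul_sum]
    refine Finset.sum_le_sum fun k hk => ?_
    have h2 := abs_apply_proj_le_sum (hc k) (hF k hk).1 x
    rw [hc0, hcL, ContinuousLinearMap.comp_apply, proj_proj, Set.inter_self] at h2
    calc _ ≤ β k * (τ / β k *
          ∑ i ∈ Finset.range (L k), ‖proj (Set.Ico (c k i) (c k (i + 1))) x‖) :=
          mul_le_mul_of_nonneg_left h2 (hβ k hk).le
      _ = _ := by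
          rw [← mul_assoc, mul_div_cancel₀ _ (hβ k hk).ne']
  have hsum := sum_sum_norm_proj_le (F := F) hc (L := L) (fun j k hjk => by
    rw [hc0, hcL]
    exact (hrl j).trans (hl.monotone hjk)) x
  -- Raise the bound of `exists_partition` to the power `q` and use `L ≤ 2 * (L / 2) + 1`; the
  -- summand 1 is the source of the error `τ ^ q`.
  have hLk : ∀ k ∈ F, τ ^ q * (L k : ℝ) ≤ 2 * (4 * D) ^ q * β k ^ q + τ ^ q := by
    intro k hk
    have hβk := hβ k hk
    have h2 := (hF k hk).2
    rw [div_mul_eq_mul_div, div_le_iff₀ hβk] at h2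
    have h3 := Real.rpow_le_rpow (by positivity) h2 hq0.le
    rw [Real.mul_rpow hτ.le (by positivity), Real.mul_rpow (by positivity) hβk.le,
      ← Real.rpow_mul (Nat.cast_nonneg _), one_div_mul_cancel hq0.ne', Real.rpow_one] at h3
    have h4 : (L k : ℝ) ≤ 2 * ((L k / 2 : ℕ) : ℝ) + 1 := by
      have : L k ≤ 2 * (L k / 2) + 1 := by omega
      exact_mod_cast this
    have h5 : 0 < τ ^ q := Real.rpow_pos_of_pos hτ q
    nlinarith
  have htot : τ ^ q * ((∑ k ∈ F, L k : ℕ) : ℝ) ≤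
      2 * (4 * D) ^ q * ∑ k ∈ F, β k ^ q + τ ^ q * F.card := by
    rw [Nat.cast_sum, Finset.mul_sum, Finset.mul_sum]
    refine (Finset.sum_le_sum hLk).trans_eq ?_
    rw [Finset.sum_add_distrib, Finset.sum_const, nsmul_eq_mul, mul_comm (F.card : ℝ)]
  calc _ ≤ γ * (τ * ∑ k ∈ F, ∑ i ∈ Finset.range (L k),
          ‖proj (Set.Ico (c k i) (c k (i + 1))) x‖) := mul_le_mul_of_nonneg_left hpieces h0.le
    _ = τ * (γ * ∑ k ∈ F, ∑ i ∈ Finset.range (L k),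
          ‖proj (Set.Ico (c k i) (c k (i + 1))) x‖) := by ring
    _ ≤ τ * (((∑ k ∈ F, L k : ℕ) : ℝ) ^ (1 / q) * ‖x‖) :=
        mul_le_mul_of_nonneg_left hsum hτ.le
    _ = (τ ^ q * ((∑ k ∈ F, L k : ℕ) : ℝ)) ^ (1 / q) * ‖x‖ := by
        rw [Real.mul_rpow (by positivity) (Nat.cast_nonneg _), ← Real.rpow_mul hτ.le,
          mul_one_div_cancel hq0.ne', Real.rpow_one, mul_assoc]
    _ ≤ _ := mul_le_mul_of_nonneg_right
        (Real.rpow_le_rpow (by positivity) htot (by positivity)) (norm_nonneg _)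

/-- The values of such functionals on a vector have a bounded `ℓ_p` norm. -/
theorem sum_rpow_le_of_small (hγ : γ ≤ 1 / 2) {f : ℕ → Tirilman p γ hp h0 h1 →L[ℝ] ℝ} {D : ℝ}
    (hD : ∀ k, ‖f k‖ ≤ D) {l r : ℕ → ℕ} {ε : ℝ} (h : BlockApprox f l r ε)
    {x : Tirilman p γ hp h0 h1} (F : Finset ℕ) (hF : ∀ k ∈ F, f k x ≠ 0)
    {τ : ℝ} (hτ : 0 < τ) (hτ1 : τ ≤ 1) (hτF : τ * F.card ≤ 1)
    (hA : 1 ≤ ∑ k ∈ F, |f k x| ^ p)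
    (hsmall : ∀ k ∈ F, ∀ i, |f k (proj (Set.Ico (l k) (r k)) (tirilmanBasis p γ hp h0 h1 i))| ≤
      τ / |f k x| ^ (p - 1)) :
    (∑ k ∈ F, |f k x| ^ p) ^ (1 / p) ≤
      ((2 * (4 * D) ^ p.conjExponent + 1) ^ (1 / p.conjExponent) / γ + 2 * ε) * ‖x‖ := by
  have hpq := Real.HolderConjugate.conjExponent hp
  have hq := hpq.symm
  have hq0 := hq.pos
  have hD0 : 0 ≤ D := (norm_nonneg _).trans (hD 0)
  set q := p.conjExponent with hqdef
  set A := ∑ k ∈ F, |f k x| ^ p with hAdef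
  have hA0 : 0 < A := one_pos.trans_le hA
  -- Weights extremal in Hölder's inequality: both `β k ^ q` and `β k * |f k x|` equal `|f k x| ^
  -- p`. The estimate becomes `A ≤ C * A ^ (1/q) * ‖x‖`, and dividing leaves `A ^ (1/p)`. The
  -- rounding error `τ ^ q * F.card ≤ 1` is absorbed by `A ≥ 1`.
  set β : ℕ → ℝ := fun k => |f k x| ^ (p - 1) with hβdef
  have hβ : ∀ k ∈ F, 0 < β k := fun k hk => Real.rpow_pos_of_pos (abs_pos.2 (hF k hk)) _
  have hβq : ∀ k, β k ^ q = |f k x| ^ p := fun k => by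
    rw [hβdef, ← Real.rpow_mul (abs_nonneg _), hpq.sub_one_mul_conj]
  have hβ1 : ∀ k ∈ F, β k * |f k x| = |f k x| ^ p := fun k hk => by
    have h2 : 0 < |f k x| := abs_pos.2 (hF k hk)
    calc β k * |f k x| = |f k x| ^ (p - 1) * |f k x| ^ (1 : ℝ) := by rw [Real.rpow_one]
      _ = _ := by rw [← Real.rpow_add h2, sub_add_cancel]
  have hβA : ∀ k ∈ F, β k ≤ A ^ (1 / q) := fun k hk => by
    rw [one_div, Real.le_rpow_inv_iff_of_pos (hβ k hk).le hA0.le hq0, hβq]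
    exact Finset.single_le_sum (f := fun k => |f k x| ^ p)
      (fun k _ => Real.rpow_nonneg (abs_nonneg _) _) hk
  have hkey := sum_mul_abs_apply_le hγ hD h.strictMono (fun k => (h.lt k).le) h.le F hβ hτ hsmall x
  rw [← hqdef] at hkey
  simp only [hβq] at hkey
  rw [← hAdef] at hkey
  have hbound : (2 * (4 * D) ^ q * A + τ ^ q * F.card) ^ (1 / q) ≤
      (2 * (4 * D) ^ q + 1) ^ (1 / q) * A ^ (1 / q) := by
    rw [← Real.mul_rpow (by positivity) hA0.le]
    refine Real.rpow_le_rpow (by positivity) ?_ (by positivity)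
    have h2 : τ ^ q ≤ τ := by
      conv_rhs => rw [← Real.rpow_one τ]
      exact Real.rpow_le_rpow_of_exponent_ge hτ hτ1 hq.lt.le
    have h3 : τ ^ q * F.card ≤ τ * F.card := mul_le_mul_of_nonneg_right h2 (Nat.cast_nonneg _)
    linarith
  set B := (2 * (4 * D) ^ q + 1) ^ (1 / q) with hB
  have hI : ∑ k ∈ F, β k * |f k (proj (Set.Ico (l k) (r k)) x)| ≤ B / γ * A ^ (1 / q) * ‖x‖ := by
    rw [← mul_le_mul_iff_of_pos_left h0]
    refine (hkey.trans (mul_le_mul_of_nonneg_right hbound (norm_nonneg _))).trans_eq ?_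
    field_simp
  have hII : ∑ k ∈ F, β k * (ε * (1 / 2) ^ k * ‖x‖) ≤ A ^ (1 / q) * (2 * ε * ‖x‖) := by
    calc _ ≤ ∑ k ∈ F, A ^ (1 / q) * (ε * ‖x‖) * (1 / 2 : ℝ) ^ k := by
          refine Finset.sum_le_sum fun k hk => ?_
          have h2 : 0 ≤ ε * (1 / 2) ^ k * ‖x‖ :=
            mul_nonneg (mul_nonneg h.nonneg (by positivity)) (norm_nonneg _)
          exact (mul_le_mul_of_nonneg_right (hβA k hk) h2).trans_eq (by ring)
      _ = A ^ (1 / q) * (ε * ‖x‖) * ∑ k ∈ F, (1 / 2 : ℝ) ^ k := by rw [Finset.mul_sum]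
      _ ≤ A ^ (1 / q) * (ε * ‖x‖) * 2 := by
          refine mul_le_mul_of_nonneg_left ?_ (mul_nonneg (by positivity)
            (mul_nonneg h.nonneg (norm_nonneg _)))
          exact (summable_geometric_two.sum_le_tsum F fun k _ => by positivity).trans_eq
            tsum_geometric_two
      _ = _ := by ring
  have hsum : A ≤ A ^ (1 / q) * ((B / γ + 2 * ε) * ‖x‖) := by
    calc A = ∑ k ∈ F, β k * |f k x| := Finset.sum_congr rfl fun k hk => (hβ1 k hk).symm
      _ ≤ ∑ k ∈ F, (β k * |f k (proj (Set.Ico (l k) (r k)) x)| +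
          β k * (ε * (1 / 2) ^ k * ‖x‖)) := by
          refine Finset.sum_le_sum fun k hk => ?_
          rw [← mul_add]
          refine mul_le_mul_of_nonneg_left ?_ (hβ k hk).le
          have h2 := abs_sub_abs_le_abs_sub (f k x) (f k (proj (Set.Ico (l k) (r k)) x))
          linarith [h.abs_sub_le k x]
      _ ≤ B / γ * A ^ (1 / q) * ‖x‖ + A ^ (1 / q) * (2 * ε * ‖x‖) := by
          rw [Finset.sum_add_distrib]
          exact add_le_add hI hII
      _ = _ := by ring
  have hpos : 0 < A ^ (1 / q) := Real.rpow_pos_of_pos hA0 _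
  refine le_of_mul_le_mul_left ?_ hpos
  rw [← Real.rpow_add hA0, one_div, one_div, hq.inv_add_inv_eq_one, Real.rpow_one]
  rw [one_div] at hsum
  exact hsum

variable {Y : Type*} [NormedAddCommGroup Y] [NormedSpace ℝ Y] [CompleteSpace Y]
  {b : SchauderBasis ℝ Y} {Q : Tirilman p γ hp h0 h1 →L[ℝ] Y}

/-- The smallness needed in `sum_rpow_le_of_small` depends on `a`. Subsymmetry lets the coefficients
be moved to a sparser subsequence selected after `a`; one lift `x` then bounds the `ℓ_p` norm on
every window, although by divergence these norms are unbounded. -/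
theorem summable_of_small_coordinates (hγ : γ ≤ 1 / 2) (hb : IsSubsymmetric b)
    (hQ : Function.Surjective Q) {φ : ℕ → ℕ} (hφ : StrictMono φ) {l r : ℕ → ℕ} {ε : ℝ}
    (h : BlockApprox (fun k => (b.coord (φ k)).comp Q) l r ε)
    (hsmall : ∀ δ > 0, ∀ᶠ k in atTop, ∀ i, |b.coord (φ k)
      (Q (proj (Set.Ico (l k) (r k)) (tirilmanBasis p γ hp h0 h1 i)))| ≤ δ)
    {a : ℕ → ℝ} (ha : SeriesConverges b a) : Summable fun k => |a k| ^ p := by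
  classical
  have hp0 : 0 < p := by linarith
  by_contra hns
  have htop := (not_summable_iff_tendsto_nat_atTop_of_nonneg
    fun k => Real.rpow_nonneg (abs_nonneg (a k)) p).1 hns
  have hv : ∀ u : ℕ, ∃ v, u < v ∧ (u : ℝ) + 1 ≤ ∑ k ∈ Finset.Ico u v, |a k| ^ p := by
    intro u
    obtain ⟨v, hv, huv⟩ := ((htop.eventually_ge_atTop
      ((u : ℝ) + 1 + ∑ k ∈ Finset.range u, |a k| ^ p)).and (eventually_gt_atTop u)).exists
    refine ⟨v, huv, ?_⟩
    rw [Finset.sum_Ico_eq_sub _ huv.le]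
    linarith
  choose v huv hv using hv
  let t : ℕ → ℕ → ℝ := fun u k =>
    if a k = 0 then 1 else (1 / ((v u - u : ℕ) : ℝ)) / |a k| ^ (p - 1)
  have hvu : ∀ u, (1 : ℝ) ≤ ((v u - u : ℕ) : ℝ) := fun u => by
    have := huv u
    exact_mod_cast (by omega : 1 ≤ v u - u)
  have ht : ∀ u k, 0 < t u k := by
    intro u k
    simp only [t]
    split_ifs with hk
    · exact one_pos
    · exact div_pos (one_div_pos.2 (one_pos.trans_le (hvu u)))
        (Real.rpow_pos_of_pos (abs_pos.2 hk) _)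
  -- An index `k` may lie in many windows, but only in ones starting at some `u ≤ k`, so finitely
  -- many thresholds are to be met.
  obtain ⟨ψ, hψ, hψs⟩ := extraction_forall_of_eventually (P := fun k j => ∀ u ≤ k, ∀ i,
    |b.coord (φ j) (Q (proj (Set.Ico (l j) (r j)) (tirilmanBasis p γ hp h0 h1 i)))| ≤ t u k)
    fun k => by
      have := (Set.finite_Iic k).eventually_all (l := atTop) (p := fun u j => ∀ i,
        |b.coord (φ j) (Q (proj (Set.Ico (l j) (r j)) (tirilmanBasis p γ hp h0 h1 i)))| ≤ t u k)
      exact this.2 fun u _ => hsmall _ (ht u k)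
  obtain ⟨D, hD⟩ := hb.exists_norm_coord_le
  obtain ⟨y, hy⟩ := (hb.subsequences (φ ∘ ψ) (hφ.comp hψ) a).1 ha
  obtain ⟨x, rfl⟩ := hQ y
  have hax : ∀ k, b.coord (φ (ψ k)) (Q x) = a k := fun k =>
    coord_eq_of_tendsto (hφ.comp hψ).injective hy k
  have hblock := h.comp hψ
  set C := ((2 * (4 * (D * ‖Q‖)) ^ p.conjExponent + 1) ^ (1 / p.conjExponent) / γ + 2 * ε) * ‖x‖
    with hC
  have hle : ∀ u : ℕ, ((u : ℝ) + 1) ^ (1 / p) ≤ C := by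
    intro u
    set F := (Finset.Ico u (v u)).filter fun k => a k ≠ 0 with hF
    have hsum : ∑ k ∈ F, |a k| ^ p = ∑ k ∈ Finset.Ico u (v u), |a k| ^ p := by
      refine Finset.sum_subset (Finset.filter_subset _ _) fun k hk hkF => ?_
      have : a k = 0 := by
        by_contra hne
        exact hkF (Finset.mem_filter.2 ⟨hk, hne⟩)
      rw [this, abs_zero, Real.zero_rpow hp0.ne']
    have hcard : (F.card : ℝ) ≤ ((v u - u : ℕ) : ℝ) := by
      have := Finset.card_filter_le (Finset.Ico u (v u)) fun k => a k ≠ 0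
      rw [Nat.card_Ico] at this
      exact_mod_cast this
    have hpos := one_pos.trans_le (hvu u)
    have hmain := sum_rpow_le_of_small hγ (f := (fun k => (b.coord (φ k)).comp Q) ∘ ψ)
      (D := D * ‖Q‖) (fun k => (ContinuousLinearMap.opNorm_comp_le _ _).trans
        (mul_le_mul_of_nonneg_right (hD _) (norm_nonneg _))) hblock (x := x) F
      (τ := 1 / ((v u - u : ℕ) : ℝ))
      (fun k hk => by
        simp only [Function.comp_apply, ContinuousLinearMap.comp_apply, hax]
        exact (Finset.mem_filter.1 hk).2)
      (one_div_pos.2 hpos) (by rw [div_le_one hpos]; exact hvu u)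
      (by rw [one_div_mul_eq_div, div_le_one hpos]; exact hcard)
      (by
        simp only [Function.comp_apply, ContinuousLinearMap.comp_apply, hax]
        rw [hsum]
        linarith [hv u, Nat.cast_nonneg (α := ℝ) u])
      (fun k hk i => by
        simp only [Function.comp_apply, ContinuousLinearMap.comp_apply, hax]
        have hk' := Finset.mem_filter.1 hk
        refine (hψs k u (Finset.mem_Ico.1 hk'.1).1 i).trans_eq ?_
        simp only [t, if_neg hk'.2])
    simp only [Function.comp_apply, ContinuousLinearMap.comp_apply, hax] at hmain
    rw [hsum] at hmain
    exact (Real.rpow_le_rpow (by positivity) (hv u) (by positivity)).trans hmain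
  have hlim : Tendsto (fun u : ℕ => ((u : ℝ) + 1) ^ (1 / p)) atTop atTop :=
    (tendsto_rpow_atTop (by positivity)).comp
      (tendsto_atTop_add_const_right _ _ tendsto_natCast_atTop_atTop)
  obtain ⟨u, hu⟩ := (hlim.eventually_gt_atTop C).exists
  exact not_le.2 hu (hle u)

end Tirilman


/-! ### From values in `ℓ_p` to a lower `p`-estimate -/

/-- Boundedness of `x ↦ (g k x)` into `ℓ_p`, phrased by duality: Hölder bounds the finite
combinations of the `g k` pointwise, and Banach–Steinhaus makes the bound uniform. -/
theorem exists_pairing_bound (hp : 1 < p) {X : Type*} [NormedAddCommGroup X]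
    [NormedSpace ℝ X] [CompleteSpace X] {g : ℕ → X →L[ℝ] ℝ}
    (hg : ∀ x, Summable fun k => |g k x| ^ p) :
    ∃ C, 0 ≤ C ∧ ∀ (F : Finset ℕ) (d : ℕ → ℝ), ∑ k ∈ F, |d k| ^ p.conjExponent ≤ 1 →
      ∀ x, ∑ k ∈ F, d k * g k x ≤ C * ‖x‖ := by
  have hq := (Real.HolderConjugate.conjExponent hp).symm
  have hp0 : 0 < p := by linarith
  let T : {z : Finset ℕ × (ℕ → ℝ) // ∑ k ∈ z.1, |z.2 k| ^ p.conjExponent ≤ 1} → X →L[ℝ] ℝ :=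
    fun z => ∑ k ∈ z.1.1, z.1.2 k • g k
  have hT : ∀ z x, T z x = ∑ k ∈ z.1.1, z.1.2 k * g k x := fun z x => by
    simp [T, _root_.sum_apply]
  obtain ⟨C, hC⟩ := banach_steinhaus (g := T) fun x => by
    refine ⟨(∑' k, |g k x| ^ p) ^ (1 / p), fun z => ?_⟩
    have hnn : ∀ k, 0 ≤ |g k x| ^ p := fun k => Real.rpow_nonneg (abs_nonneg _) _
    rw [hT, Real.norm_eq_abs]
    have h2 := Real.inner_le_Lp_mul_Lq z.1.1 (fun k => |z.1.2 k|) (fun k => |g k x|) hq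
    simp only [abs_abs, ← abs_mul] at h2
    refine (Finset.abs_sum_le_sum_abs _ _).trans (h2.trans ?_)
    refine (mul_le_of_le_one_left (Real.rpow_nonneg (Finset.sum_nonneg fun k _ => hnn k) _)
      (Real.rpow_le_one (Finset.sum_nonneg fun k _ => Real.rpow_nonneg (abs_nonneg _) _) z.2
        (one_div_pos.2 hq.pos).le)).trans ?_
    exact Real.rpow_le_rpow (Finset.sum_nonneg fun k _ => hnn k)
      ((hg x).sum_le_tsum _ fun k _ => hnn k) (by positivity)
  refine ⟨max C 0, le_max_right _ _, fun F d hd x => ?_⟩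
  have h2 := (T ⟨(F, d), hd⟩).le_of_opNorm_le ((hC _).trans (le_max_left C 0)) x
  rw [hT] at h2
  exact (le_abs_self _).trans h2

theorem exists_dual_coefficients (hp : 1 < p) (a : ℕ → ℝ) :
    ∃ d : ℕ → ℝ, (∀ k, |d k| ^ p.conjExponent = |a k| ^ p) ∧ ∀ k, d k * a k = |a k| ^ p := by
  have hpq := Real.HolderConjugate.conjExponent hp
  have hp0 : p ≠ 0 := by linarith
  have key : ∀ t : ℝ, ∃ s : ℝ, |s| ^ p.conjExponent = |t| ^ p ∧ s * t = |t| ^ p := by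
    intro t
    rcases eq_or_ne t 0 with rfl | ht
    · exact ⟨0, by simp [Real.zero_rpow hp0, Real.zero_rpow hpq.symm.ne_zero]⟩
    have ht' : 0 < |t| := abs_pos.2 ht
    have h1 : |t| ^ (p - 1) * |t| = |t| ^ p := by
      calc _ = |t| ^ (p - 1) * |t| ^ (1 : ℝ) := by rw [Real.rpow_one]
        _ = _ := by rw [← Real.rpow_add ht', sub_add_cancel]
    have h2 : (|t| ^ (p - 1)) ^ p.conjExponent = |t| ^ p := by
      rw [← Real.rpow_mul ht'.le, hpq.sub_one_mul_conj]
    have h3 : 0 ≤ |t| ^ (p - 1) := Real.rpow_nonneg ht'.le _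
    rcases lt_or_gt_of_ne ht with h | h
    · refine ⟨-|t| ^ (p - 1), by rw [abs_neg, abs_of_nonneg h3, h2], ?_⟩
      rw [← h1, abs_of_neg h]
      ring
    · refine ⟨|t| ^ (p - 1), by rw [abs_of_nonneg h3, h2], ?_⟩
      rw [← h1, abs_of_pos h]
  choose s hs1 hs2 using key
  exact ⟨fun k => s (a k), fun k => hs1 _, fun k => hs2 _⟩

namespace Tirilman

variable {hp : 1 < p} {h0 : 0 < γ} {h1 : γ < 1}

theorem restr_linearCombination {S : ℕ → Set ℕ} (hS : SuccessiveSets S) (w : ℕ → ℕ →₀ ℝ)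
    (a : ℕ →₀ ℝ) (k : ℕ) :
    restr (S k) (Finsupp.linearCombination ℝ (fun j => restr (S j) (w j)) a) =
      a k • restr (S k) (w k) := by
  ext i
  by_cases hi : i ∈ S k
  · rw [restr_of_mem hi, linearCombination_apply_of_forall_ne (i₀ := k)]
    · rfl
    · intro j hj
      refine restr_of_notMem (fun hij => ?_) _
      rcases lt_or_gt_of_ne hj with h | h
      · exact lt_irrefl _ (hS _ _ h _ hij _ hi)
      · exact lt_irrefl _ (hS _ _ h _ hi _ hij)
  · rw [restr_of_notMem hi, Finsupp.smul_apply, restr_of_notMem hi, smul_zero]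

/-- If the functionals `f k` map the space to `ℓ_p`, then vectors biorthogonal to them have a lower
`p`-estimate. -/
theorem BlockApprox.exists_lower_estimate {f : ℕ → Tirilman p γ hp h0 h1 →L[ℝ] ℝ} {l r : ℕ → ℕ}
    {ε : ℝ} (h : BlockApprox f l r ε) (hε : ε ≤ 1)
    (hf : ∀ x, Summable fun k => |f k x| ^ p) {w : ℕ → ℕ →₀ ℝ}
    (hw : ∀ k, 1 / 2 ≤ f k (of (restr (Set.Ico (l k) (r k)) (w k)))) :
    ∃ c, 0 < c ∧ ∀ a, lpSum p a = 1 → c ≤ tirilmanNorm p γ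
      (Finsupp.linearCombination ℝ (fun k => restr (Set.Ico (l k) (r k)) (w k)) a) := by
  have hp0 : 0 < p := by linarith
  have hq := (Real.HolderConjugate.conjExponent hp).symm
  obtain ⟨C, hC0, hC⟩ := exists_pairing_bound hp hf
  -- With `d` the dual coefficients of `a`, the pairing `∑ d k * f k U` is at most `C * ‖U‖` and at
  -- least `1/2 - 2 * ‖U‖`; the 2 is the sum of the localization errors.
  refine ⟨1 / (2 * (C + 2)), by positivity, fun a ha => ?_⟩
  obtain ⟨d, hd, hda⟩ := exists_dual_coefficients hp a
  set U := Finsupp.linearCombination ℝ (fun k => restr (Set.Ico (l k) (r k)) (w k)) a with hU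
  have hN := tirilmanNorm_nonneg (p := p) (γ := γ) U
  have hsum : ∑ k ∈ a.support, |a k| ^ p = 1 := ha
  have hd1 : ∀ k, |d k| ≤ 1 := fun k => by
    by_contra! hcon
    refine not_lt.2 (Real.rpow_le_one (abs_nonneg _) (abs_le_one_of_lpSum hp0 ha k) hp0.le) ?_
    rw [← hd]
    exact Real.one_lt_rpow hcon hq.pos
  have hupper := hC a.support d (by simp only [hd]; exact hsum.le) (of U)
  rw [norm_of] at hupper
  have hterm : ∀ k, |a k| ^ p * (1 / 2) - tirilmanNorm p γ U * (1 / 2) ^ k ≤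
      d k * f k (of U) := by
    intro k
    have h2 := h.abs_sub_le k (of U)
    rw [proj_of, hU, restr_linearCombination h.successiveSets, ← hU, map_smul, map_smul,
      smul_eq_mul, norm_of] at h2
    set ρ := f k (of (restr (Set.Ico (l k) (r k)) (w k))) with hρ
    have h3 : ε * (1 / 2) ^ k * tirilmanNorm p γ U ≤ tirilmanNorm p γ U * (1 / 2) ^ k := by
      have : (0 : ℝ) ≤ (1 / 2) ^ k * tirilmanNorm p γ U := by positivity
      nlinarith
    have h4 : |d k * (f k (of U) - a k * ρ)| ≤ tirilmanNorm p γ U * (1 / 2) ^ k := by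
      rw [abs_mul]
      exact (mul_le_of_le_one_left (abs_nonneg _) (hd1 k)).trans (h2.trans h3)
    have h5 : d k * (a k * ρ) = |a k| ^ p * ρ := by rw [← mul_assoc, hda]
    have h6 : |a k| ^ p * (1 / 2) ≤ |a k| ^ p * ρ :=
      mul_le_mul_of_nonneg_left (hw k) (Real.rpow_nonneg (abs_nonneg _) _)
    have h7 := (abs_le.1 h4).1
    rw [mul_sub, h5] at h7
    linarith
  have hlower : 1 / 2 - tirilmanNorm p γ U * 2 ≤ ∑ k ∈ a.support, d k * f k (of U) := by
    refine le_trans ?_ (Finset.sum_le_sum fun k _ => hterm k)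
    rw [Finset.sum_sub_distrib, ← Finset.sum_mul, hsum, one_mul, ← Finset.mul_sum]
    refine sub_le_sub_left (mul_le_mul_of_nonneg_left ?_ hN) _
    exact (summable_geometric_two.sum_le_tsum _ fun k _ => by positivity).trans_eq
      tsum_geometric_two
  rw [div_le_iff₀ (by positivity)]
  linarith

variable {Y : Type*} [NormedAddCommGroup Y] [NormedSpace ℝ Y] [CompleteSpace Y]
  {b : SchauderBasis ℝ Y} {Q : Tirilman p γ hp h0 h1 →L[ℝ] Y}

/-- A lift of `b j` of norm at most `D + 1` is approximated by a finitely supported vector, within 1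
in norm and `1/4` in the `j`-th coordinate. -/
theorem exists_finitely_supported_lift (hb : IsSubsymmetric b)
    (hQ : ∀ y, ∃ x, Q x = y ∧ ‖x‖ ≤ ‖y‖ + 1) :
    ∃ D, 0 < D ∧ ∃ w : ℕ → ℕ →₀ ℝ, ∀ j, tirilmanNorm p γ (w j) ≤ D ∧
      3 / 4 ≤ b.coord j (Q (of (w j))) := by
  obtain ⟨D, hD⟩ := hb.exists_norm_le
  obtain ⟨D', hD'⟩ := hb.exists_norm_coord_le
  have hD0 : 0 ≤ D := (norm_nonneg _).trans (hD 0)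
  have hD0' : 0 ≤ D' := (norm_nonneg _).trans (hD' 0)
  refine ⟨D + 2, by positivity, ?_⟩
  have key : ∀ j, ∃ w : ℕ →₀ ℝ, tirilmanNorm p γ w ≤ D + 2 ∧ 3 / 4 ≤ b.coord j (Q (of w)) := by
    intro j
    obtain ⟨x, hx, hxn⟩ := hQ (b j)
    set K := D' * ‖Q‖ with hK
    have hK0 : 0 ≤ K := by positivity
    obtain ⟨w, hw⟩ := exists_norm_sub_of_lt x (show 0 < 1 / (4 * (K + 1)) by positivity)
    have hw1 : ‖x - of w‖ ≤ 1 := hw.le.trans (by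
      rw [div_le_one (by positivity)]
      linarith)
    refine ⟨w, ?_, ?_⟩
    · rw [← norm_of (hp := hp) (h0 := h0) (h1 := h1)]
      have := norm_sub_norm_le (of w) x
      rw [norm_sub_rev] at this
      linarith [hD j]
    · have h2 : |b.coord j (Q (x - of w))| ≤ K * ‖x - of w‖ := by
        refine ((b.coord j).le_of_opNorm_le (hD' j) _).trans ?_
        rw [hK, mul_assoc]
        exact mul_le_mul_of_nonneg_left (Q.le_opNorm _) hD0'
      have h3 : K * ‖x - of w‖ ≤ 1 / 4 := by
        refine (mul_le_mul_of_nonneg_left hw.le hK0).trans ?_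
        rw [mul_one_div, div_le_div_iff₀ (by positivity) (by norm_num)]
        linarith
      rw [map_sub, map_sub, hx, coord_basis_self] at h2
      linarith [(abs_le.1 (h2.trans h3)).2]
  choose w hw using key
  exact ⟨w, hw⟩

/-- The unit vector basis dominates a subsymmetric basis of a quotient. -/
theorem seriesConverges_quotient_of_basis (hγ : γ < ((2 : ℝ) ^ (1 / p) - 1) / 16)
    (hγ' : γ ≤ 1 / 2) (hb : IsSubsymmetric b) (hQ : ∀ y, ∃ x, Q x = y ∧ ‖x‖ ≤ ‖y‖ + 1)
    {a : ℕ → ℝ} (ha : SeriesConverges (tirilmanBasis p γ hp h0 h1) a) : SeriesConverges b a := by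
  have hQs : Function.Surjective Q := fun y => (hQ y).imp fun x hx => hx.1
  obtain ⟨D, hD, w, hw⟩ := exists_finitely_supported_lift hb hQ
  -- The bound `1 / (4 * D)` ensures that cutting a lift to its interval lowers the coordinate from
  -- `3/4` to no less than `1/2`; the bound 1 is what `exists_lower_estimate` asks for.
  set ε : ℝ := min 1 (1 / (4 * D)) with hε
  have hε0 : 0 < ε := lt_min one_pos (by positivity)
  obtain ⟨φ, hφ, l, r, h⟩ := exists_blockApprox hγ' (f := fun j => (b.coord j).comp Q)
    (fun x => hb.tendsto_coord (Q x)) hε0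
  -- Uniformly vanishing coordinates would give a block sequence with a lower `p`-estimate;
  -- otherwise a further subsequence has a large coordinate in each interval.
  by_cases hsmall : ∀ δ > 0, ∀ᶠ k in atTop, ∀ i, |b.coord (φ k)
      (Q (proj (Set.Ico (l k) (r k)) (tirilmanBasis p γ hp h0 h1 i)))| ≤ δ
  · exfalso
    have hsum : ∀ x, Summable fun k => |((fun j => (b.coord j).comp Q) ∘ φ) k x| ^ p := fun x =>
      (summable_of_small_coordinates hγ' hb hQs hφ h hsmall
        (seriesConverges_coord (Q x))).comp_injective hφ.injective
    have hhalf : ∀ k, 1 / 2 ≤ ((fun j => (b.coord j).comp Q) ∘ φ) k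
        (of (restr (Set.Ico (l k) (r k)) (w (φ k)))) := by
      intro k
      have h2 := h.abs_sub_le k (of (w (φ k)))
      rw [proj_of, norm_of] at h2
      have h3 : ε * (1 / 2) ^ k * tirilmanNorm p γ (w (φ k)) ≤ 1 / 4 := by
        calc _ ≤ 1 / (4 * D) * 1 * D := by
              refine mul_le_mul (mul_le_mul (min_le_right _ _)
                (pow_le_one₀ (by norm_num) (by norm_num)) (by positivity) (by positivity))
                (hw _).1 (tirilmanNorm_nonneg _) (by positivity)
          _ = 1 / 4 := by field_simp
      have h4 := (hw (φ k)).2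
      have h5 := (abs_le.1 (h2.trans h3)).2
      simp only [Function.comp_apply, ContinuousLinearMap.comp_apply] at h5 ⊢
      linarith
    obtain ⟨c, hc, hl⟩ := h.exists_lower_estimate (min_le_left _ _) hsum (w := w ∘ φ) hhalf
    refine not_lower_estimate hp h0 hγ (fun i j hij k hk m hm => ?_)
      (fun k => (tirilmanNorm_restr_le hp h0 h1 _ _).trans (hw (φ k)).1) hc hl
    exact h.successiveSets i j hij k (mem_of_restr_ne_zero hk) m (mem_of_restr_ne_zero hm)
  · push Not at hsmall
    obtain ⟨δ, hδ, hfreq⟩ := hsmall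
    obtain ⟨ψ, hψ, hψδ⟩ := extraction_of_frequently_atTop hfreq
    choose i hi using hψδ
    have hmem : ∀ k, i k ∈ Set.Ico (l (ψ k)) (r (ψ k)) := by
      intro k
      by_contra hcon
      have := hi k
      rw [proj_basis_of_notMem hcon, map_zero, map_zero, abs_zero] at this
      exact lt_asymm hδ this
    refine seriesConverges_of_large_coordinates hb (hφ.comp hψ) (h.comp hψ) hmem hδ
      (fun k => ?_) ha
    have := hi k
    rw [proj_basis_of_mem (hmem k)] at this
    exact this.le

end Tirilman

end

theorem mainTheorem4 (p : ℝ) (hp : 1 < p) :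
    ∃ γ₀ : ℝ, 0 < γ₀ ∧ ∀ (γ : ℝ) (h0 : 0 < γ) (h1 : γ < 1), γ < γ₀ →
      ∀ (M : Submodule ℝ (Tirilman p γ hp h0 h1)) [IsClosed (M : Set (Tirilman p γ hp h0 h1))]
        (b : SchauderBasis ℝ (Tirilman p γ hp h0 h1 ⧸ M)), IsSubsymmetric b →
        EquivalentSequences b (tirilmanBasis p γ hp h0 h1) := by
  have hp0 : 0 < p := by linarith
  have ht1 : 1 < (2 : ℝ) ^ (1 / p) := Real.one_lt_rpow (by norm_num) (by positivity)
  have ht2 : (2 : ℝ) ^ (1 / p) ≤ 2 := by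
    conv_rhs => rw [← Real.rpow_one 2]
    exact Real.rpow_le_rpow_of_exponent_le (by norm_num) (by rw [div_le_one hp0]; exact hp.le)
  -- The threshold comes from `not_lower_estimate`. It is at most `1/16`, which also gives `γ ≤ 1/2`
  -- for the upper `p`-estimate.
  refine ⟨((2 : ℝ) ^ (1 / p) - 1) / 16, by linarith, ?_⟩
  intro γ h0 h1 hγ M _ b hb a
  have hγ' : γ ≤ 1 / 2 := by linarith
  have hQ : ∀ y, ∃ x, M.mkQL x = y ∧ ‖x‖ ≤ ‖y‖ + 1 := fun y => by
    obtain ⟨x, hx, hxn⟩ := Submodule.Quotient.norm_mk_lt y one_pos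
    exact ⟨x, hx, hxn.le⟩
  exact ⟨fun ha => Tirilman.seriesConverges_basis_of_quotient (Q := M.mkQL) hγ' hb
    (fun y => (hQ y).imp fun x hx => hx.1) ha,
    fun ha => Tirilman.seriesConverges_quotient_of_basis (Q := M.mkQL) hγ hγ' hb hQ ha⟩
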